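/- All vector spaces are over $\mathbb C$; a super vector space is a $\mathbb Z/2$-graded vector space $V=V_{\bar 0}\oplus V_{\bar 1}$ with parity $|\cdot|$, and all bilinear forms $(\cdot,\cdot)$ are consistent ($(V_{\bar 0},V_{\bar 1})=0$) and super-symmetric ($(x,y)=(-1)^{|x||y|}(y,x)$). For homogeneous bases $(x_i)$ the dual basis $(x^i)$ is given by $(x^i,x_j)=\delta_{ij}$. The Clifford algebra $C(V)$ and the exterior algebra $\Lambda(V)$ are the quotients of $T(V)$ by the relations $xy+(-1)^{|x||y|}yx=2(x,y)$, respectively $x\wedge y+(-1)^{|x||y|}y\wedge x=0$. For homogeneous $x\in V$ let $\iota(x)$ be the derivation of degree $(-1,|x|)$ of $\Lambda(V)$ with $\iota(x)y=(x,y)$, i.e. $\iota(x)(v\wedge w)=(x,v)w-(-1)^{|x||v|}v\wedge\iota(x)w$, extended linearly in $x$. The spaces $C(V)$ and $\Lambda(V)$ are identified by $\eta(u)=\gamma(u)1$, where $\gamma(x)$ is left exterior multiplication by $x$ plus $\iota(x)$. A quadratic Lie superalgebra is a Lie superalgebra with a non-degenerate form satisfying $([x,y],z)=(x,[y,z])$;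 its Casimir element is $\mathrm{Cas}=\sum_i x_ix^i$ in the enveloping algebra. Let $\mathfrak r$ be a finite dimensional quadratic Lie superalgebra with form $(\cdot,\cdot)_{\mathfrak r}$, let $\mathfrak p$ be a finite dimensional super vector space with a non-degenerate form $(\cdot,\cdot)_{\mathfrak p}$, and let $\nu:\mathfrak r\to\mathfrak{osp}(\mathfrak p)$ be a representation. Let $\mathfrak g=\mathfrak r\oplus\mathfrak p$ with the form $(\cdot,\cdot)_{\mathfrak g}$ that restricts to the two given forms and makes $\mathfrak r$ and $\mathfrak p$ orthogonal. Let $(x_i)$ and $(y_j)$ be homogeneous bases of $\mathfrak r$ and $\mathfrak p$ with dual bases $(x^i)$ and $(y^j)$, and put $$\phi_{\mathfrak r}=-\tfrac1{12}\sum_{i,j,k}(-1)^{|x_i||x_j|+|x_k||x_k|}([x_i,x_j],x_k)\,x^i\wedge x^j\wedge x^k,\qquad \phi_\nu=\sum_i\nu_*(x_i)\wedge x^i,$$ where $\nu_*:\mathfrak r\to\Lambda^2(\mathfrak p)$, $\nu_*(x)=-\tfrac14\sum_{i,j}(-1)^{|y_i||y_j|}(\nu(x)y_i,y_j)\,y^i\wedge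 y^j$, is the map with $[\nu_*(x),y]_C=\nu(x)y$ for all $y\in\mathfrak p$ (super commutator with respect to the Clifford multiplication). Extend $\nu_*$ to a homomorphism of associative algebras from $T(\mathfrak r)$ to $\Lambda(\mathfrak p)$ with the Clifford multiplication, and let $\nu_*(\mathrm{Cas}_{\mathfrak r})=\sum_i\nu_*(x_i)\nu_*(x^i)$. **Theorem.** Assume that $(\nu,(\cdot,\cdot)_{\mathfrak g})$ is of Lie super type, that is, $\mathfrak g$ carries a bracket $[\cdot,\cdot]$ making it a quadratic Lie superalgebra with respect to $(\cdot,\cdot)_{\mathfrak g}$, such that $\mathfrak r$ is a subalgebra and $[x,y]=\nu(x)y$ for $x\in\mathfrak r$, $y\in\mathfrak p$; and let $\phi_{\mathfrak p}\in\Lambda^3_{\bar 0}(\mathfrak p)$ be the corresponding cubic element, i.e. $[z_1,z_2]=2\iota(z_1)\iota(z_2)(\phi_{\mathfrak r}+\phi_\nu+\phi_{\mathfrak p})$ for all $z_1,z_2\in\mathfrak g$. Then, in $\Lambda(\mathfrak p)$ with the Clifford multiplication, $\nu_*(\mathrm{Cas}_{\mathfrak r})+\phi_{\mathfrak p}^2$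 is a constant, namely $$\nu_*(\mathrm{Cas}_{\mathfrak r})+\phi_{\mathfrak p}^2=\frac1{24}\bigl(\operatorname{str}\operatorname{ad}_{\mathfrak g}(\mathrm{Cas}_{\mathfrak g})-\operatorname{str}\operatorname{ad}_{\mathfrak r}(\mathrm{Cas}_{\mathfrak r})\bigr),$$ where $\operatorname{ad}_{\mathfrak g}$ and $\operatorname{ad}_{\mathfrak r}$ are the adjoint representations, extended to the enveloping algebras, and $\operatorname{str}$ is the supertrace. -/

import Mathlib

noncomputable section

namespace LieSuper

/-- The Koszul sign `(-1)^{ab}`. -/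
def ksign (a b : ZMod 2) : ℂ := (-1) ^ (a.val * b.val)

theorem ksign_comm (a b : ZMod 2) : ksign a b = ksign b a := by
  unfold ksign; rw [mul_comm]

theorem ksign_mul_self (a b : ZMod 2) : ksign a b * ksign a b = 1 := by
  unfold ksign; rw [← mul_pow]; simp

section Super

variable {V : Type*} [AddCommGroup V] [Module ℂ V] (𝒱 : ZMod 2 → Submodule ℂ V)

/-! ### Super vector spaces -/

/-- The projection of the super vector space `V = 𝒱 0 ⊕ 𝒱 1` onto its part of parity `a`. -/
def proj [DirectSum.Decomposition 𝒱] (a : ZMod 2) : V →ₗ[ℂ] V :=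
  (𝒱 a).subtype ∘ₗ DirectSum.component ℂ (ZMod 2) (fun i => 𝒱 i) a ∘ₗ
    (DirectSum.decomposeLinearEquiv 𝒱).toLinearMap

/-- The supertrace `tr(α) - tr(δ)`, where `α` and `δ` are the even-even and the odd-odd blocks. -/
def str [DirectSum.Decomposition 𝒱] (T : Module.End ℂ V) : ℂ :=
  LinearMap.trace ℂ V (proj 𝒱 0 ∘ₗ T) - LinearMap.trace ℂ V (proj 𝒱 1 ∘ₗ T)

theorem proj_apply [DirectSum.Decomposition 𝒱] (a : ZMod 2) (x : V) :
    proj 𝒱 a x = (DirectSum.decompose 𝒱 x a : V) := rfl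

theorem proj_mem [DirectSum.Decomposition 𝒱] (a : ZMod 2) (x : V) : proj 𝒱 a x ∈ 𝒱 a := by
  rw [proj_apply]; exact SetLike.coe_mem _

theorem proj_of_mem [DirectSum.Decomposition 𝒱] {a : ZMod 2} {x : V} (hx : x ∈ 𝒱 a) :
    proj 𝒱 a x = x := by
  rw [proj_apply, DirectSum.decompose_of_mem_same _ hx]

theorem proj_of_mem_ne [DirectSum.Decomposition 𝒱] {a b : ZMod 2} {x : V} (hx : x ∈ 𝒱 a)
    (h : a ≠ b) : proj 𝒱 b x = 0 := by
  rw [proj_apply, DirectSum.decompose_of_mem_ne _ hx h]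

theorem proj_of_mem_ite [DirectSum.Decomposition 𝒱] {a b : ZMod 2} {x : V} (hx : x ∈ 𝒱 a) :
    proj 𝒱 b x = if a = b then x else 0 := by
  split_ifs with h
  · subst h; exact proj_of_mem 𝒱 hx
  · exact proj_of_mem_ne 𝒱 hx h

theorem sum_proj [DirectSum.Decomposition 𝒱] (x : V) : ∑ a, proj 𝒱 a x = x := by
  classical
  simp_rw [proj_apply]
  conv_rhs => rw [← DirectSum.sum_support_decompose 𝒱 x]
  refine (Finset.sum_subset (Finset.subset_univ _) fun a _ ha => ?_).symm
  simpa using ha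

/-- A consistent super-symmetric bilinear form on a super vector space. -/
structure SuperForm where
  form : LinearMap.BilinForm ℂ V
  consistent : ∀ ⦃a b : ZMod 2⦄, a ≠ b → ∀ ⦃x y : V⦄, x ∈ 𝒱 a → y ∈ 𝒱 b → form x y = 0
  supersymm : ∀ ⦃a b : ZMod 2⦄ ⦃x y : V⦄, x ∈ 𝒱 a → y ∈ 𝒱 b →
    form x y = ksign a b * form y x

instance : Zero (SuperForm 𝒱) := ⟨⟨0, by simp, by simp⟩⟩

instance : Neg (SuperForm 𝒱) :=
  ⟨fun B => ⟨-B.form, fun a b h x y hx hy => by simp [B.consistent h hx hy],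
    fun a b x y hx hy => by simp [B.supersymm hx hy]⟩⟩

@[simp] theorem zero_form : (0 : SuperForm 𝒱).form = 0 := rfl

@[simp] theorem neg_form (B : SuperForm 𝒱) : (-B).form = -B.form := rfl

/-! ### Lie superalgebras, enveloping algebra, Casimir element -/

/-- `br` is the bracket of a Lie superalgebra structure on the super vector space `V`. -/
structure IsLieSuperalgebra (br : V →ₗ[ℂ] V →ₗ[ℂ] V) : Prop where
  grading : ∀ ⦃a b : ZMod 2⦄ ⦃x y : V⦄, x ∈ 𝒱 a → y ∈ 𝒱 b → br x y ∈ 𝒱 (a + b)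
  skew : ∀ ⦃a b : ZMod 2⦄ ⦃x y : V⦄, x ∈ 𝒱 a → y ∈ 𝒱 b → br x y = -(ksign a b • br y x)
  jacobi : ∀ ⦃a b : ZMod 2⦄ ⦃x y : V⦄, x ∈ 𝒱 a → y ∈ 𝒱 b → ∀ z : V,
    br x (br y z) = br (br x y) z + ksign a b • br y (br x z)

/-- `V` with bracket `br` and form `B` is a quadratic Lie superalgebra. -/
structure IsQuadratic (br : V →ₗ[ℂ] V →ₗ[ℂ] V) (B : SuperForm 𝒱) : Prop
    extends IsLieSuperalgebra 𝒱 br where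
  nondegenerate : B.form.Nondegenerate
  invariant : ∀ x y z : V, B.form (br x y) z = B.form x (br y z)

/-- The relations `xy - (-1)^{|x||y|} yx = [x,y]` of the enveloping algebra. -/
inductive UEnv.Rel (br : V →ₗ[ℂ] V →ₗ[ℂ] V) : TensorAlgebra ℂ V → TensorAlgebra ℂ V → Prop
  | of {a b : ZMod 2} {x y : V} (hx : x ∈ 𝒱 a) (hy : y ∈ 𝒱 b) :
      UEnv.Rel br
        (TensorAlgebra.ι ℂ x * TensorAlgebra.ι ℂ y
          - ksign a b • (TensorAlgebra.ι ℂ y * TensorAlgebra.ι ℂ x))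
        (TensorAlgebra.ι ℂ (br x y))

/-- The universal enveloping algebra of a Lie superalgebra. -/
def UEnv (br : V →ₗ[ℂ] V →ₗ[ℂ] V) : Type _ := RingQuot (UEnv.Rel 𝒱 br)

instance (br : V →ₗ[ℂ] V →ₗ[ℂ] V) : Ring (UEnv 𝒱 br) :=
  inferInstanceAs (Ring (RingQuot (UEnv.Rel 𝒱 br)))

instance (br : V →ₗ[ℂ] V →ₗ[ℂ] V) : Algebra ℂ (UEnv 𝒱 br) :=
  inferInstanceAs (Algebra ℂ (RingQuot (UEnv.Rel 𝒱 br)))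

/-- The quotient map `T(V) → U(V)`. -/
def UEnv.mk (br : V →ₗ[ℂ] V →ₗ[ℂ] V) : TensorAlgebra ℂ V →ₐ[ℂ] UEnv 𝒱 br :=
  RingQuot.mkAlgHom ℂ (UEnv.Rel 𝒱 br)

/-- The extension of the adjoint representation `x ↦ [x, ·]` to the enveloping algebra. -/
def adU {br : V →ₗ[ℂ] V →ₗ[ℂ] V} (h : IsLieSuperalgebra 𝒱 br) :
    UEnv 𝒱 br →ₐ[ℂ] Module.End ℂ V :=
  RingQuot.liftAlgHom ℂ ⟨TensorAlgebra.lift ℂ (A := Module.End ℂ V) br, by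
    rintro _ _ ⟨hx, hy⟩
    ext z
    simp [h.jacobi hx hy z]⟩

theorem adU_mk {br : V →ₗ[ℂ] V →ₗ[ℂ] V} (h : IsLieSuperalgebra 𝒱 br) (t : TensorAlgebra ℂ V) :
    adU 𝒱 h (UEnv.mk 𝒱 br t) = TensorAlgebra.lift ℂ (A := Module.End ℂ V) br t :=
  RingQuot.liftAlgHom_mkAlgHom_apply ℂ (s := UEnv.Rel 𝒱 br) _ _ _

/-- The tensor `∑ xᵢ ⊗ xⁱ`, where `(xⁱ)` is the dual basis of `(xᵢ)`: `(xⁱ, xⱼ) = δᵢⱼ`. -/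
def casimirTensor {ι : Type*} [Fintype ι] [DecidableEq ι] (B : LinearMap.BilinForm ℂ V)
    (hB : B.Nondegenerate) (b : Module.Basis ι ℂ V) : TensorAlgebra ℂ V :=
  ∑ i, TensorAlgebra.ι ℂ (b i) * TensorAlgebra.ι ℂ (B.dualBasis hB b i)

/-- The Casimir element `∑ xᵢ xⁱ` of the enveloping algebra. -/
def casimir {ι : Type*} [Fintype ι] [DecidableEq ι] (br : V →ₗ[ℂ] V →ₗ[ℂ] V)
    (B : LinearMap.BilinForm ℂ V) (hB : B.Nondegenerate) (b : Module.Basis ι ℂ V) : UEnv 𝒱 br :=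
  UEnv.mk 𝒱 br (casimirTensor B hB b)

/-! ### Clifford and exterior algebras -/

/-- The relations `xy + (-1)^{|x||y|} yx = 2 (x,y)` of the Clifford algebra. -/
inductive SuperClifford.Rel (B : SuperForm 𝒱) : TensorAlgebra ℂ V → TensorAlgebra ℂ V → Prop
  | of {a b : ZMod 2} {x y : V} (hx : x ∈ 𝒱 a) (hy : y ∈ 𝒱 b) :
      SuperClifford.Rel B
        (TensorAlgebra.ι ℂ x * TensorAlgebra.ι ℂ y
          + ksign a b • (TensorAlgebra.ι ℂ y * TensorAlgebra.ι ℂ x))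
        (algebraMap ℂ _ (2 * B.form x y))

/-- The Clifford algebra `C(V)` of a super vector space with a super-symmetric form. -/
def SuperClifford (B : SuperForm 𝒱) : Type _ := RingQuot (SuperClifford.Rel 𝒱 B)

/-- The exterior algebra `Λ(V)` of a super vector space: the quotient of `T(V)` by the relations
`xy + (-1)^{|x||y|} yx = 0`, that is, the Clifford algebra of the zero form. -/
abbrev SuperExterior : Type _ := SuperClifford 𝒱 0

namespace SuperClifford

instance (B : SuperForm 𝒱) : Ring (SuperClifford 𝒱 B) :=
  inferInstanceAs (Ring (RingQuot (SuperClifford.Rel 𝒱 B)))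

instance (B : SuperForm 𝒱) : Algebra ℂ (SuperClifford 𝒱 B) :=
  inferInstanceAs (Algebra ℂ (RingQuot (SuperClifford.Rel 𝒱 B)))

/-- The quotient map `T(V) → C(V)`. -/
def mk (B : SuperForm 𝒱) : TensorAlgebra ℂ V →ₐ[ℂ] SuperClifford 𝒱 B :=
  RingQuot.mkAlgHom ℂ (SuperClifford.Rel 𝒱 B)

/-- The canonical map `V → C(V)`. -/
def ι (B : SuperForm 𝒱) : V →ₗ[ℂ] SuperClifford 𝒱 B :=
  (mk 𝒱 B).toLinearMap ∘ₗ TensorAlgebra.ι ℂ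

variable {𝒱}

theorem ι_mul_ι (B : SuperForm 𝒱) {a b : ZMod 2} {x y : V} (hx : x ∈ 𝒱 a) (hy : y ∈ 𝒱 b) :
    ι 𝒱 B x * ι 𝒱 B y + ksign a b • (ι 𝒱 B y * ι 𝒱 B x) = algebraMap ℂ _ (2 * B.form x y) := by
  have := RingQuot.mkAlgHom_rel ℂ (SuperClifford.Rel.of (B := B) hx hy)
  rw [AlgHom.commutes, map_add, map_smul, map_mul, map_mul] at this
  exact this

/-- The universal property of the Clifford algebra. -/
def lift {A : Type*} [Ring A] [Algebra ℂ A] (B : SuperForm 𝒱) (f : V →ₗ[ℂ] A)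
    (hf : ∀ ⦃a b : ZMod 2⦄ ⦃x y : V⦄, x ∈ 𝒱 a → y ∈ 𝒱 b →
      f x * f y + ksign a b • (f y * f x) = algebraMap ℂ A (2 * B.form x y)) :
    SuperClifford 𝒱 B →ₐ[ℂ] A :=
  RingQuot.liftAlgHom ℂ ⟨TensorAlgebra.lift ℂ f, by
    rintro _ _ ⟨hx, hy⟩
    rw [AlgHom.commutes, ← hf hx hy]
    simp⟩

@[simp] theorem lift_ι {A : Type*} [Ring A] [Algebra ℂ A] (B : SuperForm 𝒱) (f : V →ₗ[ℂ] A)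
    (hf : ∀ ⦃a b : ZMod 2⦄ ⦃x y : V⦄, x ∈ 𝒱 a → y ∈ 𝒱 b →
      f x * f y + ksign a b • (f y * f x) = algebraMap ℂ A (2 * B.form x y)) (v : V) :
    lift B f hf (ι 𝒱 B v) = f v := by
  have := RingQuot.liftAlgHom_mkAlgHom_apply ℂ (s := SuperClifford.Rel 𝒱 B)
    (TensorAlgebra.lift ℂ f) (by
      rintro _ _ ⟨hx, hy⟩
      rw [AlgHom.commutes, ← hf hx hy]
      simp) (TensorAlgebra.ι ℂ v)
  rw [TensorAlgebra.lift_ι_apply] at this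
  exact this

/-- Two linear maps on the Clifford algebra agree if they agree at `1` and if agreement
propagates along left multiplication by homogeneous vectors. -/
theorem linearMap_ext [DirectSum.Decomposition 𝒱] {B : SuperForm 𝒱} {M : Type*} [AddCommGroup M]
    [Module ℂ M] (f g : SuperClifford 𝒱 B →ₗ[ℂ] M) (h1 : f 1 = g 1)
    (h : ∀ (a : ZMod 2) (v : V), v ∈ 𝒱 a → ∀ w, f w = g w →
      f (ι 𝒱 B v * w) = g (ι 𝒱 B v * w)) : f = g := by
  have hmul : ∀ (v : V) (w), f w = g w → f (ι 𝒱 B v * w) = g (ι 𝒱 B v * w) := by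
    intro v w hw
    rw [← sum_proj 𝒱 v]
    simp only [map_sum, Finset.sum_mul]
    exact Finset.sum_congr rfl fun a _ => h a _ (proj_mem 𝒱 a v) w hw
  have key : ∀ (t : TensorAlgebra ℂ V) (w), f w = g w → f (mk 𝒱 B t * w) = g (mk 𝒱 B t * w) := by
    intro t
    induction t using TensorAlgebra.induction with
    | algebraMap r => intro w hw; simp [← Algebra.smul_def, hw]
    | ι v => intro w hw; exact hmul v w hw
    | mul s t hs ht => intro w hw; rw [map_mul (mk 𝒱 B), mul_assoc]; exact hs _ (ht _ hw)
    | add s t hs ht => intro w hw; simp only [map_add, add_mul, hs w hw, ht w hw]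
  ext u
  obtain ⟨t, rfl⟩ := RingQuot.mkAlgHom_surjective ℂ (SuperClifford.Rel 𝒱 B) u
  have := key t 1 h1
  rw [mul_one] at this
  exact this

/-- The sign operator `v ↦ (-1)^{a|v|} v`. -/
def twist (𝒱 : ZMod 2 → Submodule ℂ V) [DirectSum.Decomposition 𝒱] (a : ZMod 2) : V →ₗ[ℂ] V :=
  ∑ b, ksign a b • proj 𝒱 b

theorem twist_of_mem [DirectSum.Decomposition 𝒱] (a : ZMod 2) {b : ZMod 2} {v : V}
    (hv : v ∈ 𝒱 b) : twist 𝒱 a v = ksign a b • v := by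
  simp [twist, LinearMap.sum_apply, proj_of_mem_ite 𝒱 hv]

/-- The linear map `v ↦ !![-(-1)^{a|v|} v, f v; 0, v]`. The upper right entry of its
multiplicative extension is the skew derivation of parity `a` that extends `f`. -/
def contractMat [DirectSum.Decomposition 𝒱] (B : SuperForm 𝒱) (a : ZMod 2) (f : V →ₗ[ℂ] ℂ) :
    V →ₗ[ℂ] Matrix (Fin 2) (Fin 2) (SuperClifford 𝒱 B) where
  toFun v := !![-ι 𝒱 B (twist 𝒱 a v), algebraMap ℂ _ (f v); 0, ι 𝒱 B v]
  map_add' u v := by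
    ext i j; fin_cases i <;> fin_cases j <;> simp [add_comm]
  map_smul' c v := by
    ext i j; fin_cases i <;> fin_cases j <;> simp [Algebra.smul_def]

theorem contractMat_apply [DirectSum.Decomposition 𝒱] (B : SuperForm 𝒱) (a : ZMod 2)
    (f : V →ₗ[ℂ] ℂ) (v : V) : contractMat B a f v =
      !![-ι 𝒱 B (twist 𝒱 a v), algebraMap ℂ _ (f v); 0, ι 𝒱 B v] := rfl

theorem contractMat_rel [DirectSum.Decomposition 𝒱] (B : SuperForm 𝒱) (a : ZMod 2)
    (f : V →ₗ[ℂ] ℂ) (hf : ∀ ⦃b : ZMod 2⦄, a ≠ b → ∀ y ∈ 𝒱 b, f y = 0)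
    ⦃b c : ZMod 2⦄ ⦃x y : V⦄ (hx : x ∈ 𝒱 b) (hy : y ∈ 𝒱 c) :
    contractMat B a f x * contractMat B a f y
      + ksign b c • (contractMat B a f y * contractMat B a f x)
      = algebraMap ℂ _ (2 * B.form x y) := by
  have hrel := ι_mul_ι B hx hy
  have hfx : f x = 0 ∨ a = b := by
    by_cases h : a = b
    · exact Or.inr h
    · exact Or.inl (hf h x hx)
  have hfy : f y = 0 ∨ a = c := by
    by_cases h : a = c
    · exact Or.inr h
    · exact Or.inl (hf h y hy)
  have hB : B.form x y = 0 ∨ b = c := by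
    by_cases h : b = c
    · exact Or.inr h
    · exact Or.inl (B.consistent h hx hy)
  ext i j
  fin_cases i <;> fin_cases j
  · simp only [contractMat, LinearMap.coe_mk, AddHom.coe_mk, twist_of_mem a hx, twist_of_mem a hy,
      map_smul, Matrix.algebraMap_eq_diagonal]
    simp only [Matrix.smul_apply, Matrix.add_apply, Matrix.mul_apply, Fin.sum_univ_two]
    simp only [Fin.zero_eta, Fin.isValue, Matrix.of_apply, Matrix.cons_val', Matrix.cons_val_zero,
      Matrix.cons_val_fin_one, Matrix.cons_val_one, mul_zero, add_zero, neg_mul_neg,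
      Matrix.diagonal_apply_eq, smul_mul_smul_comm, Pi.algebraMap_apply]
    rw [mul_comm (ksign a c), smul_comm (ksign b c), ← smul_add, hrel]
    rcases hB with h | h
    · simp [h]
    · rw [h, ksign_mul_self, one_smul]
  · simp only [contractMat, LinearMap.coe_mk, AddHom.coe_mk, twist_of_mem a hx, twist_of_mem a hy,
      map_smul, Matrix.algebraMap_eq_diagonal]
    simp only [Matrix.smul_apply, Matrix.add_apply, Matrix.mul_apply, Fin.sum_univ_two]
    simp only [Fin.zero_eta, Fin.isValue, Fin.mk_one, Matrix.of_apply, Matrix.cons_val',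
      Matrix.cons_val_zero, Matrix.cons_val_fin_one, Matrix.cons_val_one, ne_eq, zero_ne_one,
      not_false_eq_true, Matrix.diagonal_apply_ne]
    rw [← Algebra.commutes (f y) (-_), ← Algebra.commutes (f x) (-_)]
    simp only [← Algebra.smul_def]
    rcases hfx with h | h <;> rcases hfy with h' | h'
    · simp [h, h']
    · subst h'
      simp only [h, zero_smul, add_zero, zero_add]
      rw [ksign_comm b a, smul_comm (ksign a b)]; simp
    · subst h
      simp only [h', zero_smul, add_zero, zero_add]
      rw [smul_neg, smul_neg, smul_comm (f x), smul_smul (ksign a c), ksign_mul_self, one_smul]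
      simp
    · subst h; subst h'
      simp only [smul_add, smul_neg, smul_smul]
      rw [mul_left_comm (ksign a a) (f x), ksign_mul_self, mul_one, mul_comm (f y)]
      abel
  · simp [contractMat, Matrix.algebraMap_eq_diagonal]
  · simp only [contractMat, LinearMap.coe_mk, AddHom.coe_mk, Matrix.algebraMap_eq_diagonal]
    simp only [Matrix.smul_apply, Matrix.add_apply, Matrix.mul_apply, Fin.sum_univ_two]
    simp [hrel]

/-- For `f` supported on parity `a`: the skew derivation of parity `a` on `C(V)` that extends `f`.
It is the upper right entry of the multiplicative extension of `contractMat`. -/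
def skewDer [DirectSum.Decomposition 𝒱] (B : SuperForm 𝒱) (a : ZMod 2)
    (f : V →ₗ[ℂ] ℂ) (hf : ∀ ⦃b : ZMod 2⦄, a ≠ b → ∀ y ∈ 𝒱 b, f y = 0) :
    SuperClifford 𝒱 B →ₗ[ℂ] SuperClifford 𝒱 B :=
  Matrix.entryLinearMap ℂ _ 0 1 ∘ₗ (lift B _ (contractMat_rel B a f hf)).toLinearMap

theorem lift_contractMat_one_one [DirectSum.Decomposition 𝒱] (B : SuperForm 𝒱) (a : ZMod 2)
    (f : V →ₗ[ℂ] ℂ) (hf : ∀ ⦃b : ZMod 2⦄, a ≠ b → ∀ y ∈ 𝒱 b, f y = 0)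
    (w : SuperClifford 𝒱 B) : lift B _ (contractMat_rel B a f hf) w 1 1 = w := by
  have : Matrix.entryLinearMap ℂ _ 1 1 ∘ₗ (lift B _ (contractMat_rel B a f hf)).toLinearMap
      = LinearMap.id := by
    apply linearMap_ext
    · simp
    · intro b v _ w hw
      simp only [LinearMap.comp_apply, AlgHom.toLinearMap_apply, Matrix.entryLinearMap_apply,
        LinearMap.id_apply, map_mul, lift_ι, Matrix.mul_apply, Fin.sum_univ_two] at hw ⊢
      rw [hw, contractMat_apply]
      simp
  exact LinearMap.congr_fun this w

@[simp] theorem skewDer_one [DirectSum.Decomposition 𝒱] (B : SuperForm 𝒱) (a : ZMod 2)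
    (f : V →ₗ[ℂ] ℂ) (hf : ∀ ⦃b : ZMod 2⦄, a ≠ b → ∀ y ∈ 𝒱 b, f y = 0) :
    skewDer B a f hf 1 = 0 := by
  simp [skewDer]

theorem skewDer_ι_mul [DirectSum.Decomposition 𝒱] (B : SuperForm 𝒱) (a : ZMod 2)
    (f : V →ₗ[ℂ] ℂ) (hf : ∀ ⦃b : ZMod 2⦄, a ≠ b → ∀ y ∈ 𝒱 b, f y = 0) {b : ZMod 2} {v : V}
    (hv : v ∈ 𝒱 b) (w : SuperClifford 𝒱 B) :
    skewDer B a f hf (ι 𝒱 B v * w)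
      = f v • w - ksign a b • (ι 𝒱 B v * skewDer B a f hf w) := by
  have h11 := lift_contractMat_one_one B a f hf w
  simp only [skewDer, LinearMap.comp_apply, AlgHom.toLinearMap_apply, Matrix.entryLinearMap_apply,
    map_mul, lift_ι, Matrix.mul_apply, Fin.sum_univ_two]
  rw [h11]
  rw [contractMat_apply, twist_of_mem a hv]
  simp only [Matrix.of_apply, Matrix.cons_val', Matrix.cons_val_zero, Matrix.cons_val_one,
    Matrix.cons_val_fin_one, map_smul, neg_mul, smul_mul_assoc, ← Algebra.smul_def]
  abel

/-- The contraction `ι(x)` on `C(V)` (or `Λ(V)`) with respect to a super-symmetric form `A`: for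
homogeneous `x` the derivation of degree `(-1, |x|)` with `ι(x) y = A(x, y)`, that is,
`ι(x)(v w) = A(x, v) w - (-1)^{|x||v|} v ι(x)(w)`; it is linear in `x`. -/
def contract [DirectSum.Decomposition 𝒱] (B A : SuperForm 𝒱) :
    V →ₗ[ℂ] Module.End ℂ (SuperClifford 𝒱 B) :=
  ∑ a : ZMod 2,
    { toFun := fun x => skewDer B a (A.form (proj 𝒱 a x))
        (fun _ h y hy => A.consistent h (proj_mem 𝒱 a x) hy)
      map_add' := by
        intro x y
        apply linearMap_ext
        · simp
        · intro b v hv w hw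
          simp only [LinearMap.add_apply] at hw ⊢
          simp only [skewDer_ι_mul _ _ _ _ hv, hw]
          simp only [map_add, LinearMap.add_apply, mul_add, smul_add, add_smul]
          abel
      map_smul' := by
        intro c x
        apply linearMap_ext
        · simp
        · intro b v hv w hw
          simp only [LinearMap.smul_apply, RingHom.id_apply] at hw ⊢
          simp only [skewDer_ι_mul _ _ _ _ hv, hw]
          simp only [map_smul, LinearMap.smul_apply, mul_smul_comm, smul_sub, smul_eq_mul, mul_smul]
          rw [smul_comm c (ksign _ _)] }

@[simp] theorem contract_one [DirectSum.Decomposition 𝒱] (B A : SuperForm 𝒱) (x : V) :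
    contract B A x 1 = 0 := by
  simp [contract, LinearMap.sum_apply]

theorem contract_ι_mul [DirectSum.Decomposition 𝒱] (B A : SuperForm 𝒱) {a b : ZMod 2} {x v : V}
    (hx : x ∈ 𝒱 a) (hv : v ∈ 𝒱 b) (w : SuperClifford 𝒱 B) :
    contract B A x (ι 𝒱 B v * w)
      = A.form x v • w - ksign a b • (ι 𝒱 B v * contract B A x w) := by
  have key : ∀ u, contract B A x u = skewDer B a (A.form x)
      (fun _ h y hy => A.consistent h hx hy) u := by
    intro u
    simp only [contract, LinearMap.sum_apply, LinearMap.coe_mk, AddHom.coe_mk]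
    rw [Finset.sum_eq_single a]
    · simp only [proj_of_mem 𝒱 hx]
    · intro c _ hc
      have h0 : ∀ u, skewDer B c (A.form (proj 𝒱 c x))
          (fun _ h y hy => A.consistent h (proj_mem 𝒱 c x) hy) u = 0 := by
        have : skewDer B c (A.form (proj 𝒱 c x))
            (fun _ h y hy => A.consistent h (proj_mem 𝒱 c x) hy) = 0 := by
          apply linearMap_ext
          · simp
          · intro d v hv w hw
            rw [skewDer_ι_mul _ _ _ _ hv, hw, proj_of_mem_ne 𝒱 hx (Ne.symm hc)]
            simp
        intro u; rw [this]; rfl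
      exact h0 u
    · simp
  rw [key, key, skewDer_ι_mul _ _ _ _ hv]

theorem contract_ι [DirectSum.Decomposition 𝒱] (B A : SuperForm 𝒱) (x v : V) :
    contract B A x (ι 𝒱 B v) = algebraMap ℂ _ (A.form x v) := by
  have h : ∀ a b, contract B A (proj 𝒱 a x) (ι 𝒱 B (proj 𝒱 b v))
      = algebraMap ℂ _ (A.form (proj 𝒱 a x) (proj 𝒱 b v)) := by
    intro a b
    have := contract_ι_mul B A (proj_mem 𝒱 a x) (proj_mem 𝒱 b v) 1
    simpa [Algebra.smul_def] using this
  rw [← sum_proj 𝒱 x, ← sum_proj 𝒱 v]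
  simp only [map_sum, LinearMap.sum_apply, h]

theorem contract_contract [DirectSum.Decomposition 𝒱] (B A A' : SuperForm 𝒱) {a b : ZMod 2}
    {x y : V} (hx : x ∈ 𝒱 a) (hy : y ∈ 𝒱 b) (w : SuperClifford 𝒱 B) :
    contract B A x (contract B A' y w) = -(ksign a b • contract B A' y (contract B A x w)) := by
  have : contract B A x ∘ₗ contract B A' y = -(ksign a b • contract B A' y ∘ₗ contract B A x) := by
    apply linearMap_ext
    · simp
    · intro c v hv w hw
      simp only [LinearMap.comp_apply, LinearMap.neg_apply, LinearMap.smul_apply] at hw ⊢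
      simp only [contract_ι_mul _ _ hx hv, contract_ι_mul _ _ hy hv, map_sub, map_smul, hw]
      have h1 : A.form x v = 0 ∨ a = c := by
        by_cases h : a = c
        · exact Or.inr h
        · exact Or.inl (A.consistent h hx hv)
      have h2 : A'.form y v = 0 ∨ b = c := by
        by_cases h : b = c
        · exact Or.inr h
        · exact Or.inl (A'.consistent h hy hv)
      have e1 : ksign b c * A.form x v = ksign a b * A.form x v := by
        rcases h1 with h | h
        · simp [h]
        · subst h; rw [ksign_comm]
      have e2 : ksign a b * ksign a c * A'.form y v = A'.form y v := by
        rcases h2 with h | h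
        · simp [h]
        · subst h; rw [ksign_mul_self, one_mul]
      simp only [smul_sub, smul_smul, mul_neg, mul_smul_comm, smul_neg, ← mul_assoc, e1, e2]
      rw [show ksign b c * ksign a c * ksign a b = ksign a b * ksign a c * ksign b c by ring]
      abel
  exact LinearMap.congr_fun this w

/-- Left multiplication by `x` plus contraction by `x`. -/
def gamma [DirectSum.Decomposition 𝒱] (B A : SuperForm 𝒱) :
    V →ₗ[ℂ] Module.End ℂ (SuperClifford 𝒱 B) :=
  LinearMap.mul ℂ (SuperClifford 𝒱 B) ∘ₗ ι 𝒱 B + contract B A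

theorem gamma_apply [DirectSum.Decomposition 𝒱] (B A : SuperForm 𝒱) (v : V)
    (w : SuperClifford 𝒱 B) : gamma B A v w = ι 𝒱 B v * w + contract B A v w := rfl

theorem gamma_rel [DirectSum.Decomposition 𝒱] (B A C : SuperForm 𝒱)
    (h : C.form = B.form + A.form) ⦃a b : ZMod 2⦄ ⦃x y : V⦄ (hx : x ∈ 𝒱 a) (hy : y ∈ 𝒱 b) :
    gamma B A x * gamma B A y + ksign a b • (gamma B A y * gamma B A x)
      = algebraMap ℂ _ (2 * C.form x y) := by
  ext w
  have h1 : ι 𝒱 B x * (ι 𝒱 B y * w)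
      = (2 * B.form x y) • w - ksign a b • (ι 𝒱 B y * (ι 𝒱 B x * w)) := by
    rw [Algebra.smul_def, ← ι_mul_ι B hx hy, add_mul, smul_mul_assoc, mul_assoc, mul_assoc]
    abel
  simp only [LinearMap.add_apply, Module.End.mul_apply, LinearMap.smul_apply, gamma_apply, mul_add,
    map_add, Module.algebraMap_end_apply, h1, contract_ι_mul _ _ hx hy, contract_ι_mul _ _ hy hx,
    contract_contract B A A hx hy, smul_add, smul_sub, h, mul_add, add_smul, smul_smul,
    ksign_comm b a, ksign_mul_self, one_smul, ← A.supersymm hx hy, two_mul]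
  abel

/-- The linear map `C(V, B + A) → C(V, B)`, `u ↦ γ(u) 1`, where the algebra homomorphism `γ` sends
a vector `x` to left multiplication by `x` plus contraction by `x` with respect to `A`. -/
def changeForm [DirectSum.Decomposition 𝒱] (B A C : SuperForm 𝒱) (h : C.form = B.form + A.form) :
    SuperClifford 𝒱 C →ₗ[ℂ] SuperClifford 𝒱 B :=
  LinearMap.applyₗ (1 : SuperClifford 𝒱 B) ∘ₗ (lift C (gamma B A) (gamma_rel B A C h)).toLinearMap

@[simp] theorem changeForm_one [DirectSum.Decomposition 𝒱] (B A C : SuperForm 𝒱)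
    (h : C.form = B.form + A.form) : changeForm B A C h 1 = 1 := by
  simp [changeForm]

theorem changeForm_ι_mul [DirectSum.Decomposition 𝒱] (B A C : SuperForm 𝒱)
    (h : C.form = B.form + A.form) (v : V) (w : SuperClifford 𝒱 C) :
    changeForm B A C h (ι 𝒱 C v * w)
      = ι 𝒱 B v * changeForm B A C h w + contract B A v (changeForm B A C h w) := by
  simp [changeForm, gamma_apply]

theorem changeForm_contract [DirectSum.Decomposition 𝒱] (B A C : SuperForm 𝒱)
    (h : C.form = B.form + A.form) (A' : SuperForm 𝒱) (x : V) (w : SuperClifford 𝒱 C) :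
    changeForm B A C h (contract C A' x w) = contract B A' x (changeForm B A C h w) := by
  have key : ∀ a, changeForm B A C h ∘ₗ contract C A' (proj 𝒱 a x)
      = contract B A' (proj 𝒱 a x) ∘ₗ changeForm B A C h := by
    intro a
    have hx := proj_mem 𝒱 a x
    apply linearMap_ext
    · simp
    · intro b v hv w hw
      simp only [LinearMap.comp_apply] at hw ⊢
      simp only [contract_ι_mul _ _ hx hv, changeForm_ι_mul, map_add, map_sub, map_smul, hw,
        contract_contract B A' A hx hv, smul_add]
      abel
  rw [← sum_proj 𝒱 x]
  simp only [map_sum, LinearMap.sum_apply]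
  exact Finset.sum_congr rfl fun a _ => LinearMap.congr_fun (key a) w

theorem contract_neg_form [DirectSum.Decomposition 𝒱] (B A A' : SuperForm 𝒱)
    (h : A'.form = -A.form) (x : V) (w : SuperClifford 𝒱 B) :
    contract B A' x w = -contract B A x w := by
  have key : ∀ a, contract B A' (proj 𝒱 a x) = -contract B A (proj 𝒱 a x) := by
    intro a
    have hx := proj_mem 𝒱 a x
    apply linearMap_ext
    · simp
    · intro b v hv w hw
      simp only [LinearMap.neg_apply] at hw ⊢
      simp only [contract_ι_mul _ _ hx hv, hw, h, LinearMap.neg_apply, neg_smul, mul_neg, smul_neg]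
      abel
  rw [← sum_proj 𝒱 x]
  simp only [map_sum, LinearMap.sum_apply, key, LinearMap.neg_apply, Finset.sum_neg_distrib]

theorem changeForm_changeForm [DirectSum.Decomposition 𝒱] (B A C A' : SuperForm 𝒱)
    (h : C.form = B.form + A.form) (h' : B.form = C.form + A'.form) (w : SuperClifford 𝒱 C) :
    changeForm C A' B h' (changeForm B A C h w) = w := by
  have hA : A'.form = -A.form := by
    rw [h, add_assoc] at h'
    exact eq_neg_of_add_eq_zero_right (left_eq_add.mp h')
  have : changeForm C A' B h' ∘ₗ changeForm B A C h = LinearMap.id := by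
    apply linearMap_ext
    · simp
    · intro b v hv w hw
      simp only [LinearMap.comp_apply, LinearMap.id_apply] at hw ⊢
      rw [changeForm_ι_mul, map_add, changeForm_ι_mul, changeForm_contract, hw,
        contract_neg_form C A A' hA]
      abel
  exact LinearMap.congr_fun this w

/-- The linear isomorphism `η : C(V) → Λ(V)`, `η(u) = γ(u) 1`, where `γ(x)`, for a vector `x`, is
left exterior multiplication by `x` plus the contraction `ι(x)`. It identifies `C(V)` with `Λ(V)`. -/
def eta [DirectSum.Decomposition 𝒱] (B : SuperForm 𝒱) :
    SuperClifford 𝒱 B ≃ₗ[ℂ] SuperExterior 𝒱 where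
  toLinearMap := changeForm 0 B B (by simp)
  invFun := changeForm B (-B) 0 (by simp)
  left_inv := changeForm_changeForm _ _ _ _ _ _
  right_inv := changeForm_changeForm _ _ _ _ _ _

theorem eta_symm_ι_mul_ι [DirectSum.Decomposition 𝒱] (B : SuperForm 𝒱) (u v : V) :
    (eta B).symm (ι 𝒱 0 u * ι 𝒱 0 v) = ι 𝒱 B u * ι 𝒱 B v - algebraMap ℂ _ (B.form u v) := by
  have h1 : changeForm B (-B) 0 (by simp) (ι 𝒱 0 v) = ι 𝒱 B v := by
    have := changeForm_ι_mul B (-B) 0 (by simp) v 1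
    simpa using this
  have h2 := changeForm_ι_mul B (-B) 0 (by simp) u (ι 𝒱 0 v)
  rw [h1, contract_ι] at h2
  change changeForm B (-B) 0 (by simp) _ = _
  simpa [sub_eq_add_neg] using h2

end SuperClifford

/-- The subspace `Λⁿ_a(V)` of elements of degree `n` and parity `a` in the exterior algebra. -/
def SuperExterior.gradedPart (n : ℕ) (a : ZMod 2) : Submodule ℂ (SuperExterior 𝒱) :=
  Submodule.span ℂ {w | ∃ (d : Fin n → ZMod 2) (v : Fin n → V), (∀ i, v i ∈ 𝒱 (d i)) ∧
    ∑ i, d i = a ∧ w = (List.ofFn fun i => SuperClifford.ι 𝒱 0 (v i)).prod}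

variable {𝒱} in
/-- The algebra homomorphism `Λ(V) → Λ(W)` induced by an even linear map `V → W`. -/
def SuperExterior.map {W : Type*} [AddCommGroup W] [Module ℂ W] {𝒲 : ZMod 2 → Submodule ℂ W}
    (f : V →ₗ[ℂ] W) (hf : ∀ a, ∀ x ∈ 𝒱 a, f x ∈ 𝒲 a) :
    SuperExterior 𝒱 →ₐ[ℂ] SuperExterior 𝒲 :=
  SuperClifford.lift 0 (SuperClifford.ι 𝒲 0 ∘ₗ f) fun _ _ _ _ hx hy => by
    simpa using SuperClifford.ι_mul_ι 0 (hf _ _ hx) (hf _ _ hy)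

variable {𝒱} in
/-- The cubic element of `Λ³(V)` that corresponds to a quadratic Lie superalgebra, in terms of a
homogeneous basis `xᵢ`, with parities `d`, and its dual basis `xⁱ`:
`-1/12 ∑ (-1)^{|xᵢ||xⱼ| + |xₖ||xₖ|} ([xᵢ,xⱼ],xₖ) xⁱ ∧ xʲ ∧ xᵏ`. -/
def cubicElement {n : Type*} [Fintype n] [DecidableEq n] (br : V →ₗ[ℂ] V →ₗ[ℂ] V)
    (B : SuperForm 𝒱) (hB : B.form.Nondegenerate) (x : Module.Basis n ℂ V) (d : n → ZMod 2) :
    SuperExterior 𝒱 :=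
  -(1 / 12 : ℂ) • ∑ i, ∑ j, ∑ k,
    (ksign (d i) (d j) * ksign (d k) (d k) * B.form (br (x i) (x j)) (x k)) •
      (SuperClifford.ι 𝒱 0 (B.form.dualBasis hB x i) *
        SuperClifford.ι 𝒱 0 (B.form.dualBasis hB x j) *
        SuperClifford.ι 𝒱 0 (B.form.dualBasis hB x k))

end Super

/-! ### Representations and Lie super type -/

section Pair

variable {r p : Type*} [AddCommGroup r] [Module ℂ r] [AddCommGroup p] [Module ℂ p]
  (𝓇 : ZMod 2 → Submodule ℂ r) (𝓅 : ZMod 2 → Submodule ℂ p)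

/-- `ν` is a representation of the Lie superalgebra `r` on `p` with values in `osp(p)`. -/
structure IsOspRepresentation (br : r →ₗ[ℂ] r →ₗ[ℂ] r) (Bp : SuperForm 𝓅)
    (ν : r →ₗ[ℂ] Module.End ℂ p) : Prop where
  grading : ∀ ⦃a b : ZMod 2⦄ ⦃x : r⦄ ⦃y : p⦄, x ∈ 𝓇 a → y ∈ 𝓅 b → ν x y ∈ 𝓅 (a + b)
  map_bracket : ∀ ⦃a b : ZMod 2⦄ ⦃x x' : r⦄, x ∈ 𝓇 a → x' ∈ 𝓇 b →
    ν (br x x') = ν x * ν x' - ksign a b • (ν x' * ν x)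
  osp : ∀ ⦃a b : ZMod 2⦄ ⦃x : r⦄ ⦃y : p⦄, x ∈ 𝓇 a → y ∈ 𝓅 b → ∀ y' : p,
    Bp.form (ν x y) y' + ksign a b * Bp.form y (ν x y') = 0

/-- The grading of the direct sum `g = r ⊕ p`. -/
def prodGrading (a : ZMod 2) : Submodule ℂ (r × p) := (𝓇 a).prod (𝓅 a)

instance [DirectSum.Decomposition 𝓇] [DirectSum.Decomposition 𝓅] :
    DirectSum.Decomposition (prodGrading 𝓇 𝓅) :=
  DirectSum.Decomposition.ofLinearMap _
    (∑ a, DirectSum.lof ℂ (ZMod 2) (fun a => prodGrading 𝓇 𝓅 a) a ∘ₗ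
      ((proj 𝓇 a).prodMap (proj 𝓅 a)).codRestrict (prodGrading 𝓇 𝓅 a)
        (fun z => ⟨proj_mem 𝓇 a z.1, proj_mem 𝓅 a z.2⟩))
    (by
      refine LinearMap.ext fun z => ?_
      simp only [LinearMap.comp_apply, LinearMap.sum_apply, map_sum, LinearMap.id_apply,
        DirectSum.coeLinearMap_lof]
      refine Prod.ext ?_ ?_
      · rw [Prod.fst_sum]; exact sum_proj 𝓇 z.1
      · rw [Prod.snd_sum]; exact sum_proj 𝓅 z.2)
    (by
      refine DirectSum.linearMap_ext ℂ fun b => LinearMap.ext fun ⟨z, hz⟩ => ?_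
      simp only [LinearMap.comp_apply, LinearMap.sum_apply, LinearMap.id_apply,
        DirectSum.coeLinearMap_lof]
      rw [Finset.sum_eq_single b]
      · congr 1
        refine Subtype.ext (Prod.ext ?_ ?_)
        · exact proj_of_mem 𝓇 hz.1
        · exact proj_of_mem 𝓅 hz.2
      · intro a _ hab
        refine (congrArg _ ?_).trans (map_zero (DirectSum.lof ℂ (ZMod 2)
          (fun a => prodGrading 𝓇 𝓅 a) a))
        refine Subtype.ext (Prod.ext ?_ ?_)
        · exact proj_of_mem_ne 𝓇 hz.1 hab.symm
        · exact proj_of_mem_ne 𝓅 hz.2 hab.symm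
      · simp)

variable {𝓇 𝓅}

/-- The form on `g = r ⊕ p` that restricts to the given forms and makes `r` and `p` orthogonal. -/
def prodForm (Br : SuperForm 𝓇) (Bp : SuperForm 𝓅) : SuperForm (prodGrading 𝓇 𝓅) where
  form := Br.form.compl₁₂ (LinearMap.fst ℂ r p) (LinearMap.fst ℂ r p)
    + Bp.form.compl₁₂ (LinearMap.snd ℂ r p) (LinearMap.snd ℂ r p)
  consistent a b h x y hx hy := by
    simp [Br.consistent h hx.1 hy.1, Bp.consistent h hx.2 hy.2]
  supersymm a b x y hx hy := by
    simp [Br.supersymm hx.1 hy.1, Bp.supersymm hx.2 hy.2, mul_add]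

theorem prodForm_apply (Br : SuperForm 𝓇) (Bp : SuperForm 𝓅) (z w : r × p) :
    (prodForm Br Bp).form z w = Br.form z.1 w.1 + Bp.form z.2 w.2 := rfl

theorem prodForm_nondegenerate {Br : SuperForm 𝓇} {Bp : SuperForm 𝓅}
    (hBr : Br.form.Nondegenerate) (hBp : Bp.form.Nondegenerate) :
    (prodForm Br Bp).form.Nondegenerate := by
  refine ⟨fun z hz => Prod.ext ?_ ?_, fun z hz => Prod.ext ?_ ?_⟩
  · exact hBr.1 _ fun w => by simpa [prodForm_apply] using hz (w, 0)
  · exact hBp.1 _ fun w => by simpa [prodForm_apply] using hz (0, w)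
  · exact hBr.2 _ fun w => by simpa [prodForm_apply] using hz (w, 0)
  · exact hBp.2 _ fun w => by simpa [prodForm_apply] using hz (0, w)

/-- `brg` is a bracket on `g = r ⊕ p` that exhibits `(ν, (·,·)_g)` as being of Lie super type: `g`
is a quadratic Lie superalgebra, `r` is a subalgebra, and `[x, y] = ν(x) y` for `x ∈ r`, `y ∈ p`. -/
structure IsLieSuperType (br : r →ₗ[ℂ] r →ₗ[ℂ] r) (Br : SuperForm 𝓇) (Bp : SuperForm 𝓅)
    (ν : r →ₗ[ℂ] Module.End ℂ p) (brg : (r × p) →ₗ[ℂ] (r × p) →ₗ[ℂ] (r × p)) : Prop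
    extends IsQuadratic (prodGrading 𝓇 𝓅) brg (prodForm Br Bp) where
  subalgebra : ∀ x x' : r, brg (x, 0) (x', 0) = (br x x', 0)
  action : ∀ (x : r) (y : p), brg (x, 0) (0, y) = (0, ν x y)

/-- The map `ν_* : r → Λ²(p)` induced by `ν`, in terms of a homogeneous basis `yᵢ` of `p`, with
parities `d`, and its dual basis `yⁱ`:
`ν_*(x) = -1/4 ∑ (-1)^{|yᵢ||yⱼ|} (ν(x) yᵢ, yⱼ) yⁱ ∧ yʲ`. -/
def nuStar {n : Type*} [Fintype n] [DecidableEq n] (ν : r →ₗ[ℂ] Module.End ℂ p)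
    (Bp : SuperForm 𝓅) (hBp : Bp.form.Nondegenerate) (y : Module.Basis n ℂ p) (d : n → ZMod 2) :
    r →ₗ[ℂ] SuperExterior 𝓅 where
  toFun x := -(1 / 4 : ℂ) • ∑ i, ∑ j, (ksign (d i) (d j) * Bp.form (ν x (y i)) (y j)) •
    (SuperClifford.ι 𝓅 0 (Bp.form.dualBasis hBp y i) *
      SuperClifford.ι 𝓅 0 (Bp.form.dualBasis hBp y j))
  map_add' x x' := by
    simp only [map_add, LinearMap.add_apply, mul_add, add_smul, Finset.sum_add_distrib, smul_add]
  map_smul' c x := by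
    simp only [map_smul, LinearMap.smul_apply, smul_eq_mul, RingHom.id_apply, Finset.smul_sum,
      smul_smul]
    refine Finset.sum_congr rfl fun i _ => Finset.sum_congr rfl fun j _ => ?_
    congr 1; ring

theorem dualBasis_mem [DirectSum.Decomposition 𝓅] {n : Type*} [Fintype n] [DecidableEq n]
    (Bp : SuperForm 𝓅) (hBp : Bp.form.Nondegenerate) (y : Module.Basis n ℂ p) (d : n → ZMod 2)
    (hy : ∀ i, y i ∈ 𝓅 (d i)) (i : n) : Bp.form.dualBasis hBp y i ∈ 𝓅 (d i) := by
  have h0 : ∀ b, b ≠ d i → proj 𝓅 b (Bp.form.dualBasis hBp y i) = 0 := by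
    intro b hb
    refine hBp.1 _ fun w => ?_
    have : Bp.form (proj 𝓅 b (Bp.form.dualBasis hBp y i)) = 0 := by
      refine y.ext fun j => ?_
      by_cases hj : b = d j
      · have e : Bp.form (Bp.form.dualBasis hBp y i) (y j)
            = Bp.form (proj 𝓅 b (Bp.form.dualBasis hBp y i)) (y j) := by
          conv_lhs => rw [← sum_proj 𝓅 (Bp.form.dualBasis hBp y i)]
          rw [map_sum, LinearMap.sum_apply, Finset.sum_eq_single b]
          · intro c _ hc
            exact Bp.consistent (fun h => hc (h.trans hj.symm)) (proj_mem 𝓅 c _) (hy j)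
          · simp
        rw [← e, LinearMap.BilinForm.apply_dualBasis_left, if_neg]
        · rfl
        · rintro rfl; exact hb hj
      · exact Bp.consistent hj (proj_mem 𝓅 b _) (hy j)
    rw [this]; rfl
  have h1 := sum_proj 𝓅 (Bp.form.dualBasis hBp y i)
  rw [Finset.sum_eq_single (d i) (fun b _ hb => h0 b hb) (by simp)] at h1
  rw [← h1]
  exact proj_mem 𝓅 _ _

/-- The map `ν_*` satisfies `[ν_*(x), w]_C = ν(x) w`, its defining property. -/
theorem nuStar_commutator [DirectSum.Decomposition 𝓅] {n : Type*} [Fintype n] [DecidableEq n]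
    {br : r →ₗ[ℂ] r →ₗ[ℂ] r} {ν : r →ₗ[ℂ] Module.End ℂ p} {Bp : SuperForm 𝓅}
    (hν : IsOspRepresentation 𝓇 𝓅 br Bp ν)
    (hBp : Bp.form.Nondegenerate) (y : Module.Basis n ℂ p) (d : n → ZMod 2)
    (hy : ∀ i, y i ∈ 𝓅 (d i)) {a b : ZMod 2} {x : r} {w : p} (hx : x ∈ 𝓇 a) (hw : w ∈ 𝓅 b) :
    (SuperClifford.eta Bp).symm (nuStar ν Bp hBp y d x) * SuperClifford.ι 𝓅 Bp w
      - ksign a b • (SuperClifford.ι 𝓅 Bp w *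
        (SuperClifford.eta Bp).symm (nuStar ν Bp hBp y d x)) = SuperClifford.ι 𝓅 Bp (ν x w) := by
  set D := Bp.form.dualBasis hBp y with hD
  have hDm : ∀ i, D i ∈ 𝓅 (d i) := dualBasis_mem Bp hBp y d hy
  have sgn : ∀ i j, Bp.form (ν x (y i)) (y j) ≠ 0 → ksign a b = ksign (d i) b * ksign (d j) b := by
    intro i j h
    have h1 : a + d i = d j := by
      by_contra hne
      exact h (Bp.consistent hne (hν.grading hx (hy i)) (hy j))
    have h2 : ∀ u v c : ZMod 2, ksign u c = ksign v c * ksign (u + v) c := by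
      intro u v c
      fin_cases u <;> fin_cases v <;> fin_cases c <;>
        simp +decide [ksign]
    rw [← h1]; exact h2 _ _ _
  -- the commutator of a single quadratic monomial with `w`
  have mono : ∀ i j, Bp.form (ν x (y i)) (y j) •
      ((SuperClifford.ι 𝓅 Bp (D i) * SuperClifford.ι 𝓅 Bp (D j)
          - algebraMap ℂ _ (Bp.form (D i) (D j))) * SuperClifford.ι 𝓅 Bp w
        - ksign a b • (SuperClifford.ι 𝓅 Bp w * (SuperClifford.ι 𝓅 Bp (D i) *
          SuperClifford.ι 𝓅 Bp (D j) - algebraMap ℂ _ (Bp.form (D i) (D j)))))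
      = Bp.form (ν x (y i)) (y j) • ((2 * Bp.form (D j) w) • SuperClifford.ι 𝓅 Bp (D i)
        - (ksign (d j) b * (2 * Bp.form (D i) w)) • SuperClifford.ι 𝓅 Bp (D j)) := by
    intro i j
    by_cases h : Bp.form (ν x (y i)) (y j) = 0
    · simp [h]
    congr 1
    have r1 := SuperClifford.ι_mul_ι Bp (hDm j) hw
    have r2 := SuperClifford.ι_mul_ι Bp (hDm i) hw
    have r3 : Bp.form (D i) (D j) • SuperClifford.ι 𝓅 Bp w
        = ksign a b • Bp.form (D i) (D j) • SuperClifford.ι 𝓅 Bp w := by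
      by_cases hc : d i = d j
      · rw [sgn i j h, hc, ksign_mul_self, one_smul]
      · rw [Bp.consistent hc (hDm i) (hDm j)]; simp
    rw [sub_mul, mul_sub, ← Algebra.commutes _ (SuperClifford.ι 𝓅 Bp w), ← Algebra.smul_def,
      smul_sub, ← r3, sgn i j h]
    rw [Algebra.algebraMap_eq_smul_one] at r1 r2
    have r1' : SuperClifford.ι 𝓅 Bp (D j) * SuperClifford.ι 𝓅 Bp w
        = (2 * Bp.form (D j) w) • (1 : SuperClifford 𝓅 Bp)
          - ksign (d j) b • (SuperClifford.ι 𝓅 Bp w * SuperClifford.ι 𝓅 Bp (D j)) := by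
      rw [← r1]; abel
    have r2' : SuperClifford.ι 𝓅 Bp (D i) * SuperClifford.ι 𝓅 Bp w
        = (2 * Bp.form (D i) w) • (1 : SuperClifford 𝓅 Bp)
          - ksign (d i) b • (SuperClifford.ι 𝓅 Bp w * SuperClifford.ι 𝓅 Bp (D i)) := by
      rw [← r2]; abel
    rw [mul_assoc, r1', mul_sub, mul_smul_comm, mul_one, mul_smul_comm, ← mul_assoc, r2', sub_mul,
      smul_mul_assoc, one_mul, smul_mul_assoc, smul_sub, smul_smul, smul_smul,
      mul_comm (ksign (d i) b), mul_assoc]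
    abel
  -- expansions in the basis and in the dual basis
  have ex1 : ∑ j, Bp.form (D j) w • y j = w := by
    have : ∀ j, y.repr w j = Bp.form (D j) w := by
      intro j
      conv_rhs => rw [← y.sum_repr w]
      simp only [map_sum, map_smul, hD, LinearMap.BilinForm.apply_dualBasis_left, smul_eq_mul]
      simp
    simp_rw [← this]; exact y.sum_repr w
  have ex2 : ∀ v : p, ∑ j, Bp.form v (y j) • D j = v := by
    intro v
    have := D.sum_repr v
    simp_rw [hD, LinearMap.BilinForm.dualBasis_repr_apply] at this
    exact this
  have hs : ∀ i, ksign (d i) b * Bp.form (D i) w = ksign b b * Bp.form (D i) w := by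
    intro i
    by_cases h : d i = b
    · rw [h]
    · rw [Bp.consistent h (hDm i) hw]; simp
  have S1 : ∑ i, ∑ j, (ksign (d i) (d j) * Bp.form (ν x (y i)) (y j) * Bp.form (D j) w) •
      SuperClifford.ι 𝓅 Bp (D i) = -SuperClifford.ι 𝓅 Bp (ν x w) := by
    have e : ∀ i, ∑ j, (ksign (d i) (d j) * Bp.form (ν x (y i)) (y j) * Bp.form (D j) w) •
        SuperClifford.ι 𝓅 Bp (D i)
        = -(Bp.form (ν x w) (y i) • SuperClifford.ι 𝓅 Bp (D i)) := by
      intro i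
      have e1 : ∀ j, ksign (d i) (d j) * Bp.form (ν x (y i)) (y j) * Bp.form (D j) w
          = ksign (d i) b * (Bp.form (D j) w * Bp.form (ν x (y i)) (y j)) := by
        intro j
        by_cases h : d j = b
        · rw [h]; ring
        · rw [Bp.consistent h (hDm j) hw]; simp
      have e2 : Bp.form (ν x (y i)) w = ∑ j, Bp.form (D j) w * Bp.form (ν x (y i)) (y j) := by
        conv_lhs => rw [← ex1]
        simp [map_sum]
      rw [← Finset.sum_smul, Finset.sum_congr rfl fun j _ => e1 j, ← Finset.mul_sum, ← e2,
        ← neg_smul]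
      congr 1
      have o := hν.osp hx hw (y i)
      rw [Bp.supersymm hw (hν.grading hx (hy i)), ← mul_assoc] at o
      have k : ∀ a b c : ZMod 2, ksign a b * ksign b (a + c) = ksign c b := by
        intro u v c
        fin_cases u <;> fin_cases v <;> fin_cases c <;> simp +decide [ksign]
      rw [k] at o
      linear_combination o
    rw [Finset.sum_congr rfl fun i _ => e i, Finset.sum_neg_distrib]
    conv_rhs => rw [← ex2 (ν x w)]
    simp only [map_sum, map_smul]
  have S2 : ∑ i, ∑ j, (ksign (d i) (d j) * Bp.form (ν x (y i)) (y j) *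
      (ksign (d j) b * Bp.form (D i) w)) • SuperClifford.ι 𝓅 Bp (D j)
      = SuperClifford.ι 𝓅 Bp (ν x w) := by
    have e : ∀ i j, ksign (d i) (d j) * Bp.form (ν x (y i)) (y j) *
        (ksign (d j) b * Bp.form (D i) w)
        = Bp.form (ν x (Bp.form (D i) w • y i)) (y j) := by
      intro i j
      rw [map_smul, map_smul, LinearMap.smul_apply, smul_eq_mul]
      by_cases h : d i = b
      · rw [h, ksign_comm b]
        linear_combination (Bp.form (D i) w * Bp.form (ν x (y i)) (y j)) * ksign_mul_self (d j) b
      · rw [Bp.consistent h (hDm i) hw]; simp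
    simp_rw [e, ← map_smul (SuperClifford.ι 𝓅 Bp), ← map_sum (SuperClifford.ι 𝓅 Bp), ex2,
      ← map_sum, ex1]
  have hq : (SuperClifford.eta Bp).symm (nuStar ν Bp hBp y d x)
      = -(1 / 4 : ℂ) • ∑ i, ∑ j, (ksign (d i) (d j) * Bp.form (ν x (y i)) (y j)) •
        (SuperClifford.ι 𝓅 Bp (D i) * SuperClifford.ι 𝓅 Bp (D j)
          - algebraMap ℂ _ (Bp.form (D i) (D j))) := by
    simp only [nuStar, LinearMap.coe_mk, AddHom.coe_mk, map_smul, map_sum,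
      SuperClifford.eta_symm_ι_mul_ι, hD]
  have hcomb : (SuperClifford.eta Bp).symm (nuStar ν Bp hBp y d x) * SuperClifford.ι 𝓅 Bp w
      - ksign a b • (SuperClifford.ι 𝓅 Bp w *
        (SuperClifford.eta Bp).symm (nuStar ν Bp hBp y d x))
      = -(1 / 4 : ℂ) • ∑ i, ∑ j, ksign (d i) (d j) • (Bp.form (ν x (y i)) (y j) •
        ((2 * Bp.form (D j) w) • SuperClifford.ι 𝓅 Bp (D i)
        - (ksign (d j) b * (2 * Bp.form (D i) w)) • SuperClifford.ι 𝓅 Bp (D j))) := by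
    simp_rw [← mono]
    rw [hq]
    simp only [smul_mul_assoc, mul_smul_comm, Finset.sum_mul, Finset.mul_sum, Finset.smul_sum,
      ← Finset.sum_sub_distrib]
    refine Finset.sum_congr rfl fun i _ => Finset.sum_congr rfl fun j _ => ?_
    simp only [smul_sub, smul_smul]
    congr 2
    ring
  rw [hcomb]
  have hfin : ∀ i j, ksign (d i) (d j) • (Bp.form (ν x (y i)) (y j) •
        ((2 * Bp.form (D j) w) • SuperClifford.ι 𝓅 Bp (D i)
        - (ksign (d j) b * (2 * Bp.form (D i) w)) • SuperClifford.ι 𝓅 Bp (D j)))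
      = (2 : ℂ) • ((ksign (d i) (d j) * Bp.form (ν x (y i)) (y j) * Bp.form (D j) w) •
        SuperClifford.ι 𝓅 Bp (D i)) - (2 : ℂ) • ((ksign (d i) (d j) * Bp.form (ν x (y i)) (y j) *
        (ksign (d j) b * Bp.form (D i) w)) • SuperClifford.ι 𝓅 Bp (D j)) := by
    intro i j
    simp only [smul_sub, smul_smul]
    congr 2 <;> ring
  simp_rw [hfin, Finset.sum_sub_distrib, ← Finset.smul_sum]
  rw [S1, S2]
  module

/-- The inclusion `Λ(r) → Λ(g)`. -/
def extInl : SuperExterior 𝓇 →ₐ[ℂ] SuperExterior (prodGrading 𝓇 𝓅) :=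
  SuperExterior.map (LinearMap.inl ℂ r p) fun a _ hx => ⟨hx, (𝓅 a).zero_mem⟩

/-- The inclusion `Λ(p) → Λ(g)`. -/
def extInr : SuperExterior 𝓅 →ₐ[ℂ] SuperExterior (prodGrading 𝓇 𝓅) :=
  SuperExterior.map (LinearMap.inr ℂ r p) fun a _ hy => ⟨(𝓇 a).zero_mem, hy⟩

/-- The cubic element `φ_ν = ∑ ν_*(xᵢ) ∧ xⁱ` of `Λ(g)`. -/
def phiNu {m : Type*} [Fintype m] [DecidableEq m] (Br : SuperForm 𝓇)
    (hBr : Br.form.Nondegenerate) (x : Module.Basis m ℂ r) (νs : r →ₗ[ℂ] SuperExterior 𝓅) :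
    SuperExterior (prodGrading 𝓇 𝓅) :=
  ∑ i, extInr (νs (x i)) * extInl (SuperClifford.ι 𝓇 0 (Br.form.dualBasis hBr x i))

/-- The extension of `ν_* : r → Λ²(p)` to `T(r)` as a homomorphism to `Λ(p)` with the Clifford
multiplication, that is, to `C(p)`, which is identified with `Λ(p)` by `η`. -/
def nuStarLift [DirectSum.Decomposition 𝓅] (Bp : SuperForm 𝓅) (νs : r →ₗ[ℂ] SuperExterior 𝓅) :
    TensorAlgebra ℂ r →ₐ[ℂ] SuperClifford 𝓅 Bp :=
  TensorAlgebra.lift ℂ ((SuperClifford.eta Bp).symm.toLinearMap ∘ₗ νs)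

end Pair

end LieSuper

end

noncomputable section

namespace LieSuper

/-! Put $w=\nu_*(\mathrm{Cas}_{\mathfrak r})+\phi_{\mathfrak p}^2$ in $C(\mathfrak p)$. Contractions
are compatible with $\eta$, obey a Leibniz rule on Clifford products, and equal half the super
commutator with a vector (`ι_mul_sub`). The kernel of the Euler operator on $\Lambda(\mathfrak p)$
is $\mathbb C\cdot 1$, so an element killed by all contractions is a constant
(`eq_algebraMap_constTerm`), and it is zero if its constant term also vanishes
(`eq_zero_of_contract_eq_zero`).

It therefore suffices to show $\iota(v)w=0$ for all $v$, by descent. The constant term of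
$\iota(v)w$ vanishes because $w$ has even degree. That of $\iota(w')\iota(v)w$ vanishes by symmetry
of the form: the Casimir operator is self-adjoint, and the pairing of the quadratic elements
$\iota(v)\phi_{\mathfrak p}$ is super-symmetric. The triple contraction $\iota(u)\iota(w')\iota(v)w$
is a vector: $\phi_{\mathfrak p}^2$ contributes the terms of the $\mathfrak p$-component of the
Jacobi identity for $u,w',v$ that only use the $\mathfrak p$-part of brackets, and the Casimir
element contributes those that pass through $\mathfrak r$. Their sum is zero.

The constant is then the constant term of $w$. Write $C_{\mathfrak p}=\sum_i\nu(x_i)\nu(x^i)$ and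
let $\Sigma$ be the signed sum of $([y_j,y_i]_{\mathfrak p},[y^j,y^i]_{\mathfrak p})$. The two
summands of $w$ have constant terms $\frac18\operatorname{str}C_{\mathfrak p}$ (`constTerm_casimir`)
and $-\frac1{24}\Sigma$ (`constTerm_cubic_sq`), while `str_casimirEnd_prod` gives the difference of
the supertraces as $3\operatorname{str}C_{\mathfrak p}-\Sigma$. -/

theorem ksign_add_left (a b c : ZMod 2) : ksign (a + b) c = ksign a c * ksign b c := by
  fin_cases a <;> fin_cases b <;> fin_cases c <;> simp +decide [ksign]

theorem ksign_add_right (a b c : ZMod 2) : ksign a (b + c) = ksign a b * ksign a c := by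
  rw [ksign_comm, ksign_add_left, ksign_comm b, ksign_comm c]

theorem ksign_zero_right (a : ZMod 2) : ksign a 0 = 1 := by simp [ksign]

theorem ksign_zero_left (a : ZMod 2) : ksign 0 a = 1 := by simp [ksign]

/-! ### Dual homogeneous bases and the supertrace. -/

section Super

variable {V : Type*} [AddCommGroup V] [Module ℂ V] {𝒱 : ZMod 2 → Submodule ℂ V}

theorem SuperForm.eq_zero_or_eq (B : SuperForm 𝒱) {a b : ZMod 2} {x y : V} (hx : x ∈ 𝒱 a)
    (hy : y ∈ 𝒱 b) : B.form x y = 0 ∨ a = b := by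
  by_cases h : a = b
  · exact Or.inr h
  · exact Or.inl (B.consistent h hx hy)

/-- A linear map that vanishes on homogeneous vectors is zero. -/
theorem linearMap_ext_homogeneous [DirectSum.Decomposition 𝒱] {M : Type*} [AddCommGroup M]
    [Module ℂ M] {f g : V →ₗ[ℂ] M} (h : ∀ a, ∀ v ∈ 𝒱 a, f v = g v) : f = g := by
  ext v
  rw [← sum_proj 𝒱 v, map_sum, map_sum]
  exact Finset.sum_congr rfl fun a _ => h a _ (proj_mem 𝒱 a v)

section Basis

variable {n : Type*} [Fintype n] [DecidableEq n] (B : SuperForm 𝒱) (hB : B.form.Nondegenerate)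
  (y : Module.Basis n ℂ V) {d : n → ZMod 2}

theorem sum_form_smul_dualBasis (v : V) :
    ∑ i, B.form v (y i) • B.form.dualBasis hB y i = v := by
  have := (B.form.dualBasis hB y).sum_repr v
  simp_rw [LinearMap.BilinForm.dualBasis_repr_apply] at this
  exact this

theorem repr_eq_form_dualBasis (v : V) (i : n) :
    y.repr v i = B.form (B.form.dualBasis hB y i) v := by
  conv_rhs => rw [← y.sum_repr v]
  simp only [map_sum, map_smul, LinearMap.BilinForm.apply_dualBasis_left, smul_eq_mul]
  simp

theorem sum_form_dualBasis_smul (v : V) :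
    ∑ i, B.form (B.form.dualBasis hB y i) v • y i = v := by
  simp_rw [← repr_eq_form_dualBasis]
  exact y.sum_repr v

/-- The canonical tensor `∑ yᵢ ⊗ yⁱ` is super-symmetric. -/
theorem sum_dualBasis_swap [DirectSum.Decomposition 𝒱] (hy : ∀ i, y i ∈ 𝒱 (d i)) {M : Type*}
    [AddCommGroup M] [Module ℂ M] (c : ZMod 2 → ℂ) (f : V →ₗ[ℂ] V →ₗ[ℂ] M) :
    ∑ i, c (d i) • f (y i) (B.form.dualBasis hB y i)
      = ∑ i, (c (d i) * ksign (d i) (d i)) • f (B.form.dualBasis hB y i) (y i) := by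
  set D := B.form.dualBasis hB y with hD
  -- Expanding $y_i$ in the dual basis turns both sides into double sums weighted by the Gram
  -- matrix, which is super-symmetric and pairs only equal parities. The weight `c` makes room for
  -- parity-dependent signs.
  have e1 : ∀ i, c (d i) • f (y i) (D i)
      = ∑ j, (c (d i) * B.form (y i) (y j)) • f (D j) (D i) := by
    intro i
    conv_lhs => rw [← sum_form_smul_dualBasis B hB y (y i)]
    simp only [map_sum, map_smul, LinearMap.sum_apply, LinearMap.smul_apply, Finset.smul_sum,
      smul_smul, ← hD]
  have e2 : ∀ i, (c (d i) * ksign (d i) (d i)) • f (D i) (y i)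
      = ∑ j, (c (d i) * ksign (d i) (d i) * B.form (y i) (y j)) • f (D i) (D j) := by
    intro i
    conv_lhs => rw [← sum_form_smul_dualBasis B hB y (y i)]
    simp only [map_sum, map_smul, Finset.smul_sum, smul_smul, ← hD]
  simp_rw [e1, e2]
  rw [Finset.sum_comm]
  refine Finset.sum_congr rfl fun i _ => Finset.sum_congr rfl fun j _ => ?_
  congr 1
  rw [B.supersymm (hy j) (hy i)]
  rcases B.eq_zero_or_eq (hy i) (hy j) with h | h
  · simp [h]
  · rw [h]; ring

/-- The supertrace in a homogeneous basis. -/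
theorem str_eq_sum [DirectSum.Decomposition 𝒱] (hy : ∀ i, y i ∈ 𝒱 (d i)) (T : Module.End ℂ V) :
    str 𝒱 T = ∑ i, ksign (d i) (d i) * B.form (B.form.dualBasis hB y i) (T (y i)) := by
  have hD := dualBasis_mem B hB y d hy
  have key : ∀ a, LinearMap.trace ℂ V (proj 𝒱 a ∘ₗ T)
      = ∑ i, if d i = a then B.form (B.form.dualBasis hB y i) (T (y i)) else 0 := by
    intro a
    rw [LinearMap.trace_eq_matrix_trace ℂ y, Matrix.trace]
    refine Finset.sum_congr rfl fun i _ => ?_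
    rw [Matrix.diag_apply, LinearMap.toMatrix_apply, repr_eq_form_dualBasis B hB,
      LinearMap.comp_apply]
    have e : ∀ v, B.form (B.form.dualBasis hB y i) v
        = ∑ b, B.form (B.form.dualBasis hB y i) (proj 𝒱 b v) := by
      intro v; rw [← map_sum, sum_proj]
    split_ifs with h
    · subst h
      rw [e (T (y i)), Finset.sum_eq_single (d i)]
      · intro b _ hb
        exact B.consistent hb.symm (hD i) (proj_mem 𝒱 b _)
      · simp
    · exact B.consistent h (hD i) (proj_mem 𝒱 a _)
  rw [str, key, key, ← Finset.sum_sub_distrib]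
  refine Finset.sum_congr rfl fun i _ => ?_
  have h2 : ∀ a : ZMod 2, a = 0 ∨ a = 1 := by decide
  rcases h2 (d i) with h | h <;> simp [h, ksign, ZMod.val_one]

end Basis

/-! ### Contractions, sign automorphisms and constant terms. -/

namespace SuperClifford

variable [DirectSum.Decomposition 𝒱] (B A : SuperForm 𝒱)

/-- The automorphism `v ↦ -(-1)^{a|v|} v` of the Clifford algebra. -/
def signAut (a : ZMod 2) : SuperClifford 𝒱 B →ₐ[ℂ] SuperClifford 𝒱 B :=
  lift B (-(ι 𝒱 B ∘ₗ twist 𝒱 a)) fun b c x y hx hy => by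
    simp only [LinearMap.neg_apply, LinearMap.comp_apply, twist_of_mem a hx, twist_of_mem a hy,
      map_smul, neg_mul_neg, smul_mul_smul_comm]
    rw [mul_comm (ksign a c), smul_comm (ksign b c), ← smul_add, ι_mul_ι B hx hy]
    rcases B.eq_zero_or_eq hx hy with h | h
    · simp [h]
    · rw [h, ksign_mul_self, one_smul]

theorem signAut_ι (a : ZMod 2) {b : ZMod 2} {v : V} (hv : v ∈ 𝒱 b) :
    signAut B a (ι 𝒱 B v) = -(ksign a b • ι 𝒱 B v) := by
  simp [signAut, twist_of_mem a hv]

variable {B A}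

/-- `signAut B a` collects what $\iota(x)$ picks up in passing a factor: a minus sign for each
vector and the Koszul signs. The general Leibniz rule then follows by induction on the left factor.
-/
theorem contract_mul {a : ZMod 2} {x : V} (hx : x ∈ 𝒱 a) (u w : SuperClifford 𝒱 B) :
    contract B A x (u * w) = contract B A x u * w + signAut B a u * contract B A x w := by
  have : contract B A x ∘ₗ LinearMap.mulRight ℂ w
      = LinearMap.mulRight ℂ w ∘ₗ contract B A x
        + LinearMap.mulRight ℂ (contract B A x w) ∘ₗ (signAut B a).toLinearMap := by
    apply linearMap_ext
    · simp
    · intro b v hv u hu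
      simp only [LinearMap.comp_apply, LinearMap.add_apply, LinearMap.mulRight_apply,
        AlgHom.toLinearMap_apply] at hu ⊢
      rw [mul_assoc, contract_ι_mul B A hx hv, contract_ι_mul B A hx hv, hu, map_mul,
        signAut_ι B a hv]
      simp only [mul_add, smul_add, sub_mul, smul_mul_assoc, neg_mul, mul_assoc]
      abel
  exact LinearMap.congr_fun this u

/-- The super commutator with a vector is twice the contraction. -/
theorem ι_mul_sub {a : ZMod 2} {x : V} (hx : x ∈ 𝒱 a) (w : SuperClifford 𝒱 B) :
    ι 𝒱 B x * w - signAut B a w * ι 𝒱 B x = (2 : ℂ) • contract B B x w := by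
  have : LinearMap.mulLeft ℂ (ι 𝒱 B x)
      - LinearMap.mulRight ℂ (ι 𝒱 B x) ∘ₗ (signAut B a).toLinearMap
      = (2 : ℂ) • contract B B x := by
    apply linearMap_ext
    · simp
    · intro b v hv w hw
      simp only [LinearMap.sub_apply, LinearMap.comp_apply, LinearMap.mulRight_apply,
        LinearMap.mulLeft_apply, AlgHom.toLinearMap_apply, LinearMap.smul_apply] at hw ⊢
      rw [contract_ι_mul B B hx hv, smul_sub, smul_comm (2 : ℂ) (ksign a b), ← mul_smul_comm (2 : ℂ),
        ← hw, map_mul, signAut_ι B a hv, ← mul_assoc, smul_smul,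
        Algebra.smul_def (2 * _) w, ← ι_mul_ι B hx hv]
      simp only [add_mul, mul_sub, smul_sub, smul_mul_assoc, neg_mul, mul_assoc]
      abel
  exact LinearMap.congr_fun this w

/-- A contraction changes the degree by one, whence the minus sign, and the parity by $|x|$, whence
the Koszul sign. -/
theorem signAut_contract (a : ZMod 2) {b : ZMod 2} {x : V} (hx : x ∈ 𝒱 b)
    (w : SuperClifford 𝒱 B) :
    signAut B a (contract B A x w) = -(ksign a b • contract B A x (signAut B a w)) := by
  have : (signAut B a).toLinearMap ∘ₗ contract B A x
      = -(ksign a b • contract B A x ∘ₗ (signAut B a).toLinearMap) := by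
    apply linearMap_ext
    · simp
    · intro c v hv w hw
      simp only [LinearMap.comp_apply, LinearMap.neg_apply, LinearMap.smul_apply,
        AlgHom.toLinearMap_apply] at hw ⊢
      rw [contract_ι_mul B A hx hv, map_sub, map_smul, map_smul, map_mul, map_mul, hw,
        signAut_ι B a hv]
      rw [neg_mul (ksign a c • ι 𝒱 B v) (signAut B a w), map_neg, smul_mul_assoc, map_smul,
        contract_ι_mul B A hx hv]
      rcases A.eq_zero_or_eq hx hv with h | h
      · simp only [h, zero_smul, zero_sub, neg_mul, smul_mul_assoc, mul_neg, mul_smul_comm,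
          smul_neg, neg_neg, smul_smul]
        module
      · subst h
        simp only [neg_mul, smul_mul_assoc, mul_neg, mul_smul_comm,
          smul_neg, neg_neg, smul_smul, smul_sub, ← mul_assoc, ksign_mul_self, one_mul]
        congr 2
        rw [mul_one]
  exact LinearMap.congr_fun this w

theorem eta_one : eta B 1 = 1 := changeForm_one 0 B B (by simp)

theorem eta_ι_mul (v : V) (w : SuperClifford 𝒱 B) :
    eta B (ι 𝒱 B v * w) = ι 𝒱 0 v * eta B w + contract 0 B v (eta B w) :=
  changeForm_ι_mul 0 B B (by simp) _ _

theorem eta_contract (x : V) (w : SuperClifford 𝒱 B) :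
    eta B (contract B A x w) = contract 0 A x (eta B w) :=
  changeForm_contract 0 B B (by simp) _ _ _

theorem eta_ι (v : V) : eta B (ι 𝒱 B v) = ι 𝒱 0 v := by
  have := eta_ι_mul (B := B) v 1
  simpa [eta_one] using this

/-- Exterior multiplication by $v$ and contraction by $v$ acquire the same factor $-(-1)^{a|v|}$, so
$\gamma(v)$ does too. -/
theorem eta_signAut (a : ZMod 2) (w : SuperClifford 𝒱 B) :
    eta B (signAut B a w) = signAut 0 a (eta B w) := by
  have : (eta B).toLinearMap ∘ₗ (signAut B a).toLinearMap
      = (signAut 0 a).toLinearMap ∘ₗ (eta B).toLinearMap := by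
    apply linearMap_ext
    · simp [eta_one]
    · intro b v hv w hw
      simp only [LinearMap.comp_apply, AlgHom.toLinearMap_apply, LinearEquiv.coe_coe] at hw ⊢
      rw [map_mul (signAut B a), signAut_ι B a hv, eta_ι_mul, map_add, map_mul (signAut 0 a),
        signAut_ι 0 a hv,
        neg_mul (ksign a b • ι 𝒱 B v), map_neg, smul_mul_assoc, map_smul, eta_ι_mul, hw,
            signAut_contract a hv]
      simp only [smul_add, neg_mul, smul_mul_assoc]
      abel
  exact LinearMap.congr_fun this w

/-- The augmentation `Λ(V) → ℂ`. -/
def augmentation : SuperExterior 𝒱 →ₐ[ℂ] ℂ := lift 0 0 (by simp)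

omit [DirectSum.Decomposition 𝒱] in
theorem augmentation_ι (v : V) : augmentation (ι 𝒱 0 v) = 0 := by simp [augmentation]

variable (B) in
/-- The constant term of an element of the Clifford algebra, identified with `Λ(V)` by `η`. -/
def constTerm : SuperClifford 𝒱 B →ₗ[ℂ] ℂ := augmentation.toLinearMap ∘ₗ (eta B).toLinearMap

theorem constTerm_apply (w : SuperClifford 𝒱 B) : constTerm B w = augmentation (eta B w) := rfl

@[simp] theorem constTerm_one : constTerm B (1 : SuperClifford 𝒱 B) = 1 := by
  simp [constTerm_apply, eta_one]

/-- An exterior multiple of $v$ has no constant term, so only the contraction in $\gamma(v)$ counts.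
All constant terms below are computed by this rule. -/
theorem constTerm_ι_mul (v : V) (w : SuperClifford 𝒱 B) :
    constTerm B (ι 𝒱 B v * w) = constTerm B (contract B B v w) := by
  simp [constTerm_apply, eta_ι_mul, eta_contract, augmentation_ι]

theorem constTerm_ι_mul_ι (v w : V) :
    constTerm B (ι 𝒱 B v * ι 𝒱 B w) = B.form v w := by
  simp [constTerm_ι_mul, contract_ι, Algebra.algebraMap_eq_smul_one]

end SuperClifford

/-! ### The Euler operator on the exterior algebra and its kernel. -/

namespace SuperExterior

open SuperClifford

variable [DirectSum.Decomposition 𝒱]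

theorem signAut_of_mem_gradedPart {k : ℕ} {a : ZMod 2} {w : SuperExterior 𝒱}
    (hw : w ∈ gradedPart 𝒱 k a) (b : ZMod 2) :
    signAut 0 b w = ((-1) ^ k * ksign b a) • w := by
  induction hw using Submodule.span_induction with
  | mem w hw =>
    obtain ⟨d, v, hv, rfl, rfl⟩ := hw
    induction k with
    | zero => simp [ksign_zero_right]
    | succ k ih =>
      rw [List.ofFn_succ, List.prod_cons, map_mul, ih _ _ fun i => hv i.succ, signAut_ι 0 b (hv 0),
        Fin.sum_univ_succ, ksign_add_right, pow_succ]
      rw [← neg_smul, smul_mul_smul_comm]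
      congr 1
      ring
  | zero => simp
  | add u w _ _ hu hw => rw [map_add, hu, hw, smul_add]
  | smul c w _ hw => rw [map_smul, hw, smul_comm]

variable {n : Type*} [Fintype n] [DecidableEq n] (B : SuperForm 𝒱) (hB : B.form.Nondegenerate)
  (y : Module.Basis n ℂ V) (d : n → ZMod 2)

/-- The Euler operator on the exterior algebra: multiplication by `k` on `Λᵏ(V)`. -/
def euler : Module.End ℂ (SuperExterior 𝒱) :=
  ∑ i, ksign (d i) (d i) •
    LinearMap.mulLeft ℂ (ι 𝒱 0 (B.form.dualBasis hB y i)) ∘ₗ contract 0 B (y i)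

theorem euler_apply (w : SuperExterior 𝒱) : euler B hB y d w =
    ∑ i, ksign (d i) (d i) • (ι 𝒱 0 (B.form.dualBasis hB y i) * contract 0 B (y i) w) := by
  simp [euler, LinearMap.sum_apply]

@[simp] theorem euler_one : euler B hB y d 1 = 0 := by simp [euler_apply]

variable {d} (hy : ∀ i, y i ∈ 𝒱 (d i))
include hy

/-- The scalar parts of the contractions reassemble $v$ from its coordinates. In the other parts the
signs from moving $y^i$ and $\iota(y_i)$ past $v$ cancel. So the operator is an even derivation that
is the identity on vectors. -/
theorem euler_ι_mul (v : V) (w : SuperExterior 𝒱) :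
    euler B hB y d (ι 𝒱 0 v * w) = ι 𝒱 0 v * w + ι 𝒱 0 v * euler B hB y d w := by
  have hD := dualBasis_mem B hB y d hy
  have : (euler B hB y d ∘ₗ LinearMap.mulRight ℂ w) ∘ₗ ι 𝒱 0
      = (LinearMap.mulRight ℂ w + LinearMap.mulRight ℂ (euler B hB y d w)) ∘ₗ ι 𝒱 0 := by
    refine linearMap_ext_homogeneous (𝒱 := 𝒱) fun a v hv => ?_
    simp only [LinearMap.comp_apply, LinearMap.add_apply, LinearMap.mulRight_apply]
    have e : ∀ i, ksign (d i) (d i) • (ι 𝒱 0 (B.form.dualBasis hB y i) *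
        contract 0 B (y i) (ι 𝒱 0 v * w))
        = (B.form v (y i) • ι 𝒱 0 (B.form.dualBasis hB y i)) * w
          + ι 𝒱 0 v * (ksign (d i) (d i) • (ι 𝒱 0 (B.form.dualBasis hB y i) *
            contract 0 B (y i) w)) := by
      intro i
      have h1 := ι_mul_ι 0 (hD i) hv
      have h2 : ksign (d i) (d i) * B.form (y i) v = B.form v (y i) := by
        rw [B.supersymm hv (hy i)]
        rcases B.eq_zero_or_eq (hy i) hv with h | h
        · simp [h]
        · rw [h]
      have h3 : ι 𝒱 0 (B.form.dualBasis hB y i) * ι 𝒱 0 v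
          = -(ksign (d i) a • (ι 𝒱 0 v * ι 𝒱 0 (B.form.dualBasis hB y i))) := by
        rw [eq_neg_iff_add_eq_zero, h1]; simp
      rw [contract_ι_mul 0 B (hy i) hv, mul_sub, mul_smul_comm, mul_smul_comm, ← mul_assoc, h3,
        smul_sub, smul_smul, h2]
      simp only [neg_mul, smul_mul_assoc, mul_smul_comm, mul_assoc, smul_neg, smul_smul]
      rw [ksign_mul_self, mul_one]
      abel
    rw [euler_apply, Finset.sum_congr rfl fun i _ => e i, Finset.sum_add_distrib,
      ← Finset.sum_mul, ← Finset.mul_sum, ← euler_apply]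
    simp_rw [← map_smul]
    rw [← map_sum, sum_form_smul_dualBasis]
  exact LinearMap.congr_fun this v

theorem euler_of_mem_gradedPart {k : ℕ} {a : ZMod 2} {w : SuperExterior 𝒱}
    (hw : w ∈ gradedPart 𝒱 k a) : euler B hB y d w = (k : ℂ) • w := by
  induction hw using Submodule.span_induction with
  | mem w hw =>
    obtain ⟨c, v, hv, -, rfl⟩ := hw
    induction k with
    | zero => simp
    | succ k ih =>
      rw [List.ofFn_succ, List.prod_cons, euler_ι_mul B hB y hy, ih _ _ fun i => hv i.succ]
      push_cast
      rw [mul_smul_comm]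
      module
  | zero => simp
  | add u w _ _ hu hw => rw [map_add, hu, hw, smul_add]
  | smul c w _ hw => rw [map_smul, hw, smul_comm]

omit hy in
theorem augmentation_euler (w : SuperExterior 𝒱) : augmentation (euler B hB y d w) = 0 := by
  simp [euler_apply, augmentation_ι]

/-- This says that contraction has degree $-1$. Contracting the factor $y^i$ yields $\sum_i
(y^i,v)\,\iota(y_i)=\iota(v)$, and the remaining terms commute. -/
theorem euler_contract (v : V) (w : SuperExterior 𝒱) :
    euler B hB y d (contract 0 B v w)
      = contract 0 B v (euler B hB y d w) - contract 0 B v w := by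
  have hD := dualBasis_mem B hB y d hy
  have : euler B hB y d ∘ₗ (contract 0 B).flip w
      = (contract 0 B).flip (euler B hB y d w) - (contract 0 B).flip w := by
    refine linearMap_ext_homogeneous (𝒱 := 𝒱) fun a v hv => ?_
    simp only [LinearMap.comp_apply, LinearMap.sub_apply, LinearMap.flip_apply]
    have e : ∀ i, contract 0 B v (ksign (d i) (d i) • (ι 𝒱 0 (B.form.dualBasis hB y i) *
        contract 0 B (y i) w))
        = contract 0 B (B.form (B.form.dualBasis hB y i) v • y i) w
          + ksign (d i) (d i) • (ι 𝒱 0 (B.form.dualBasis hB y i) *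
            contract 0 B (y i) (contract 0 B v w)) := by
      intro i
      rw [map_smul, contract_ι_mul 0 B hv (hD i), contract_contract 0 B B hv (hy i),
        map_smul, LinearMap.smul_apply, smul_sub, smul_smul]
      have h2 : ksign (d i) (d i) * B.form v (B.form.dualBasis hB y i)
          = B.form (B.form.dualBasis hB y i) v := by
        rw [B.supersymm (hD i) hv]
        rcases B.eq_zero_or_eq hv (hD i) with h | h
        · simp [h]
        · rw [h]
      rw [h2]
      simp only [mul_neg, mul_smul_comm, smul_neg, smul_smul, ksign_mul_self, one_smul,
        sub_neg_eq_add]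
    rw [euler_apply _ _ _ _ w, map_sum, Finset.sum_congr rfl fun i _ => e i,
      Finset.sum_add_distrib, ← LinearMap.sum_apply, ← map_sum, sum_form_dualBasis_smul,
      ← euler_apply]
    abel
  exact LinearMap.congr_fun this v

/-- $\Lambda(V)$ is the sum of $\mathbb C\cdot 1$ and the eigenspaces for the eigenvalues
$1,2,\dots$; eigenspaces are independent, so the last ones meet the kernel in zero. -/
theorem eq_smul_one_of_euler_eq_zero {w : SuperExterior 𝒱} (hw : euler B hB y d w = 0) :
    ∃ c : ℂ, w = c • 1 := by
  set E := euler B hB y d with hE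
  set P : Submodule ℂ (SuperExterior 𝒱) := ⨆ k : ℕ, E.eigenspace ((k + 1 : ℕ) : ℂ) with hP
  set S := Submodule.span ℂ {(1 : SuperExterior 𝒱)} ⊔ P with hS
  -- Multiplication by a vector raises the eigenvalue by one, so it maps all of `S` into `P`.
  have hstep : ∀ (v : V) (w), w ∈ S → ι 𝒱 0 v * w ∈ S := by
    intro v w hw
    suffices h : S ≤ P.comap (LinearMap.mulLeft ℂ (ι 𝒱 0 v)) from
      Submodule.mem_sup_right (h hw)
    refine sup_le ?_ (iSup_le fun k => ?_)
    · rw [Submodule.span_singleton_le_iff_mem, Submodule.mem_comap, LinearMap.mulLeft_apply, hP]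
      refine Submodule.mem_iSup_of_mem 0 ?_
      rw [Module.End.mem_eigenspace_iff, euler_ι_mul B hB y hy, euler_one]
      simp
    · intro u hu
      rw [Module.End.mem_eigenspace_iff] at hu
      rw [Submodule.mem_comap, LinearMap.mulLeft_apply, hP]
      refine Submodule.mem_iSup_of_mem (k + 1) ?_
      rw [Module.End.mem_eigenspace_iff, euler_ι_mul B hB y hy, ← hE, hu, mul_smul_comm]
      push_cast
      module
  -- Induction over Clifford words, applied to the quotient map by `S`, shows that `S` is
  -- everything.
  have htop : S.mkQ = 0 := by
    apply linearMap_ext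
    · exact (Submodule.Quotient.mk_eq_zero S).2
        (Submodule.mem_sup_left (Submodule.mem_span_singleton_self _))
    · intro a v _ w hw
      exact (Submodule.Quotient.mk_eq_zero S).2
        (hstep v w ((Submodule.Quotient.mk_eq_zero S).1 hw))
  have hwS : w ∈ S := (Submodule.Quotient.mk_eq_zero S).1 (LinearMap.congr_fun htop w)
  obtain ⟨u, hu, w', hw', rfl⟩ := Submodule.mem_sup.1 hwS
  obtain ⟨c, rfl⟩ := Submodule.mem_span_singleton.1 hu
  have hE' : E w' = 0 := by simpa [hE] using hw
  have hdis := E.eigenspaces_iSupIndep (0 : ℂ)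
  have h0 : w' ∈ E.eigenspace (0 : ℂ) := by
    rw [Module.End.mem_eigenspace_iff, hE', zero_smul]
  have h1 : w' ∈ ⨆ j, ⨆ (_ : j ≠ (0 : ℂ)), E.eigenspace j := by
    refine (iSup_le fun k => ?_ : P ≤ _) hw'
    exact le_iSup₂_of_le ((k + 1 : ℕ) : ℂ) (by exact_mod_cast Nat.succ_ne_zero k) le_rfl
  exact ⟨c, by rw [Submodule.disjoint_def.1 hdis w' h0 h1, add_zero]⟩

end SuperExterior

/-! ### Elements determined by their contractions. -/

namespace SuperClifford

open SuperExterior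

variable [DirectSum.Decomposition 𝒱] {n : Type*} [Fintype n] [DecidableEq n] {B : SuperForm 𝒱}
  (hB : B.form.Nondegenerate) (y : Module.Basis n ℂ V) {d : n → ZMod 2} (hy : ∀ i, y i ∈ 𝒱 (d i))
include hB hy

/-- An element of the Clifford algebra all of whose contractions vanish is a constant. -/
theorem eq_algebraMap_constTerm {w : SuperClifford 𝒱 B}
    (h : ∀ a, ∀ v ∈ 𝒱 a, contract B B v w = 0) : w = algebraMap ℂ _ (constTerm B w) := by
  obtain ⟨c, hc⟩ := eq_smul_one_of_euler_eq_zero B hB y hy (w := eta B w) (by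
    rw [euler_apply]
    refine Finset.sum_eq_zero fun i _ => ?_
    rw [← eta_contract, h _ _ (hy i)]
    simp)
  have hw : w = c • 1 := by
    apply (eta B).injective
    rw [hc, map_smul, eta_one]
  rw [hw, map_smul, constTerm_one, Algebra.algebraMap_eq_smul_one, smul_eq_mul, mul_one]

/-- The step of the descent: applied to a contraction, it trades its vanishing for one constant term
and further contractions. -/
theorem eq_zero_of_contract_eq_zero {w : SuperClifford 𝒱 B} (h0 : constTerm B w = 0)
    (h : ∀ a, ∀ v ∈ 𝒱 a, contract B B v w = 0) : w = 0 := by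
  rw [eq_algebraMap_constTerm hB y hy h, h0, map_zero]

end SuperClifford

end Super

/-! ### The square of a cubic element and the constant terms of products. -/

namespace SuperClifford

open SuperExterior

variable {V : Type*} [AddCommGroup V] [Module ℂ V] {𝒱 : ZMod 2 → Submodule ℂ V}
  [DirectSum.Decomposition 𝒱] {B : SuperForm 𝒱}

theorem constTerm_signAut (a : ZMod 2) (w : SuperClifford 𝒱 B) :
    constTerm B (signAut B a w) = constTerm B w := by
  have : augmentation.toLinearMap ∘ₗ (signAut 0 a).toLinearMap
      = (augmentation (𝒱 := 𝒱)).toLinearMap := by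
    apply linearMap_ext
    · simp
    · intro b v hv w _
      simp [signAut_ι 0 a hv, augmentation_ι]
  rw [constTerm_apply, eta_signAut, constTerm_apply]
  exact LinearMap.congr_fun this (eta B w)

/-- The contraction of an element of even degree has odd degree, hence no constant term. -/
theorem constTerm_contract_eq_zero {w : SuperClifford 𝒱 B} (hw : signAut B 0 w = w) {a : ZMod 2}
    {v : V} (hv : v ∈ 𝒱 a) : constTerm B (contract B B v w) = 0 := by
  have h := constTerm_signAut 0 (contract B B v w)
  rw [signAut_contract 0 hv, hw, ksign_zero_left, one_smul, map_neg] at h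
  exact self_eq_neg.1 h.symm

section Cubic

variable {φ : SuperClifford 𝒱 B} {m : V →ₗ[ℂ] V →ₗ[ℂ] V}
  (hodd : ∀ a, signAut B a φ = -φ)
  (hm : ∀ u v, (2 : ℂ) • contract B B u (contract B B v φ) = ι 𝒱 B (m u v))
  (hgr : ∀ ⦃a b : ZMod 2⦄ ⦃u v : V⦄, u ∈ 𝒱 a → v ∈ 𝒱 b → m u v ∈ 𝒱 (a + b))

include hm in
theorem contract_contract_eq (u v : V) :
    contract B B u (contract B B v φ) = ι 𝒱 B ((1 / 2 : ℂ) • m u v) := by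
  rw [map_smul, ← hm, smul_smul]; norm_num

include hodd in
theorem signAut_contract_of_odd (a : ZMod 2) {b : ZMod 2} {v : V} (hv : v ∈ 𝒱 b) :
    signAut B a (contract B B v φ) = ksign a b • contract B B v φ := by
  rw [signAut_contract a hv, hodd, map_neg, smul_neg, neg_neg]

include hodd in
theorem contract_sq {a : ZMod 2} {v : V} (hv : v ∈ 𝒱 a) :
    contract B B v (φ * φ) = contract B B v φ * φ - φ * contract B B v φ := by
  rw [contract_mul hv, hodd, neg_mul, sub_eq_add_neg]

include hodd hm hgr in
-- When both contractions hit the same factor, the result is $\frac12(m\varphi+\varphi m)$ with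
-- $m=m(w,v)$. As $\varphi$ has odd degree and even parity, this is half a super commutator with a
-- vector, hence $\iota(m)\varphi$.
theorem contract_contract_sq {a b : ZMod 2} {v w : V} (hv : v ∈ 𝒱 a) (hw : w ∈ 𝒱 b) :
    contract B B w (contract B B v (φ * φ)) = contract B B (m w v) φ
      + ksign b a • (contract B B v φ * contract B B w φ)
      - contract B B w φ * contract B B v φ := by
  have h := ι_mul_sub (hgr hw hv) φ
  rw [hodd, neg_mul, sub_neg_eq_add] at h
  have h' : contract B B (m w v) φ
      = (1 / 2 : ℂ) • (ι 𝒱 B (m w v) * φ + φ * ι 𝒱 B (m w v)) := by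
    rw [h, smul_smul]; norm_num
  rw [contract_sq hodd hv, map_sub, contract_mul hw, contract_mul hw,
    signAut_contract_of_odd hodd b hv, hodd, contract_contract_eq hm, h', map_smul]
  simp only [smul_mul_assoc, mul_smul_comm, neg_mul, smul_add]
  module

include hodd hm hgr in
-- The products of a vector with a quadratic element pair up into super commutators, which are
-- contractions again, so only vectors survive. They are the terms of the Jacobi expression of $m$.
theorem contract_contract_contract_sq {a b c : ZMod 2} {u v w : V} (hv : v ∈ 𝒱 a) (hw : w ∈ 𝒱 b)
    (hu : u ∈ 𝒱 c) :
    contract B B u (contract B B w (contract B B v (φ * φ)))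
      = ι 𝒱 B ((1 / 2 : ℂ) • (m u (m w v) - m (m u w) v + ksign b a • m (m u v) w)) := by
  have e1 := ι_mul_sub (hgr hu hw) (contract B B v φ)
  have e2 := ι_mul_sub (hgr hu hv) (contract B B w φ)
  rw [signAut_contract_of_odd hodd _ hv, hm, ksign_add_left] at e1
  rw [signAut_contract_of_odd hodd _ hw, hm, ksign_add_left] at e2
  rw [contract_contract_sq hodd hm hgr hv hw, map_sub, map_add, map_smul, contract_mul hu,
    contract_mul hu, signAut_contract_of_odd hodd c hv, signAut_contract_of_odd hodd c hw]
  simp only [contract_contract_eq hm, map_smul, map_add, map_sub, ← e1, ← e2]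
  simp only [smul_mul_assoc, mul_smul_comm, smul_sub, smul_add, smul_smul]
  rw [ksign_comm a b]
  have e3 : (1 / 2 : ℂ) * (ksign b a * (ksign c b * ksign b a)) = 1 / 2 * ksign c b := by
    linear_combination (1 / 2 * ksign c b) * ksign_mul_self b a
  rw [e3]
  module

end Cubic

variable {n : Type*} [Fintype n] [DecidableEq n]
  (hB : B.form.Nondegenerate) (y : Module.Basis n ℂ V) {d : n → ZMod 2}

theorem constTerm_eq_zero_of_euler {k : ℂ} (hk : k ≠ 0) {w : SuperClifford 𝒱 B}
    (hw : euler B hB y d (eta B w) = k • eta B w) : constTerm B w = 0 := by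
  have h := augmentation_euler B hB y (d := d) (eta B w)
  rw [hw, map_smul, smul_eq_mul] at h
  exact (mul_eq_zero.1 h).resolve_left hk

/-- The Euler operator in terms of the Clifford multiplication. -/
theorem sum_ι_mul_contract (w : SuperClifford 𝒱 B) :
    ∑ i, ksign (d i) (d i) • (ι 𝒱 B (B.form.dualBasis hB y i) * contract B B (y i) w)
      = (eta B).symm (euler B hB y d (eta B w)) + ∑ i, ksign (d i) (d i) •
        contract B B (B.form.dualBasis hB y i) (contract B B (y i) w) := by
  apply (eta B).injective
  rw [map_add, LinearEquiv.apply_symm_apply, euler_apply, map_sum, map_sum,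
    ← Finset.sum_add_distrib]
  refine Finset.sum_congr rfl fun i _ => ?_
  rw [map_smul, map_smul, eta_ι_mul, eta_contract, eta_contract, eta_contract, smul_add]

variable (hy : ∀ i, y i ∈ 𝒱 (d i))
include hy

theorem euler_eta_contract {k : ℂ} {w : SuperClifford 𝒱 B}
    (hw : euler B hB y d (eta B w) = k • eta B w) (v : V) :
    euler B hB y d (eta B (contract B B v w)) = (k - 1) • eta B (contract B B v w) := by
  rw [eta_contract, euler_contract B hB y hy, hw, map_smul, sub_smul, one_smul]

/-- The constant term of a product whose first factor lies in `Λ²(V)`. -/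
theorem constTerm_mul_of_euler_eq_two {G F : SuperClifford 𝒱 B} {g f : n → V} {c : ZMod 2}
    (hG : euler B hB y d (eta B G) = (2 : ℂ) • eta B G)
    (hg : ∀ j, contract B B (y j) G = ι 𝒱 B (g j))
    (hf : ∀ j, contract B B (B.form.dualBasis hB y j) F = ι 𝒱 B (f j))
    (hgc : ∀ j, g j ∈ 𝒱 (d j + c)) (hF : constTerm B F = 0) :
    constTerm B (G * F) = -(1 / 2) * ∑ j, ksign (d j) c * B.form (g j) (f j) := by
  have hD := dualBasis_mem B hB y d hy
  -- For `G` of degree two, the Euler formula writes $2G$ as a sum of products $y^jg_j$ minus a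
  -- scalar; the scalar does not matter because `F` has no constant term.
  have h1 := sum_ι_mul_contract hB y (d := d) G
  rw [hG, map_smul, LinearEquiv.symm_apply_apply] at h1
  simp_rw [hg, contract_ι] at h1
  have h2 := congrArg (fun w => constTerm B (w * F)) h1
  simp only [Finset.sum_mul, add_mul, smul_mul_assoc, map_add, map_smul, map_sum, smul_eq_mul,
    ← Algebra.smul_def, hF, mul_zero, Finset.sum_const_zero, add_zero] at h2
  have h3 : ∀ j, ksign (d j) (d j) *
      constTerm B (ι 𝒱 B (B.form.dualBasis hB y j) * ι 𝒱 B (g j) * F)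
      = -(ksign (d j) c * B.form (g j) (f j)) := by
    intro j
    rw [mul_assoc, constTerm_ι_mul, contract_ι_mul B B (hD j) (hgc j), hf, map_sub, map_smul, hF,
      map_smul, constTerm_ι_mul_ι, ksign_add_right, smul_zero, smul_eq_mul]
    linear_combination -(ksign (d j) c * B.form (g j) (f j)) * ksign_mul_self (d j) (d j)
  rw [Finset.sum_congr rfl fun j _ => h3 j, Finset.sum_neg_distrib] at h2
  linear_combination -(1 / 2) * h2

section Cubic

variable {φ : SuperClifford 𝒱 B} {m : V →ₗ[ℂ] V →ₗ[ℂ] V}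
  (hodd : ∀ a, signAut B a φ = -φ)
  (hm : ∀ u v, (2 : ℂ) • contract B B u (contract B B v φ) = ι 𝒱 B (m u v))
  (hgr : ∀ ⦃a b : ZMod 2⦄ ⦃u v : V⦄, u ∈ 𝒱 a → v ∈ 𝒱 b → m u v ∈ 𝒱 (a + b))
  (hE : euler B hB y d (eta B φ) = (3 : ℂ) • eta B φ)

include hE hm hgr in
-- The factor $\frac18$ is the $\frac12$ of the product formula for $\Lambda^2$ times one $\frac12$
-- from each $\iota\iota\varphi=\frac12m$.
theorem constTerm_contract_mul_contract
    {b : ZMod 2} (v : V) {w : V} (hw : w ∈ 𝒱 b) :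
    constTerm B (contract B B w φ * contract B B v φ)
      = -(1 / 8) * ∑ j, ksign (d j) b * B.form (m (y j) w) (m (B.form.dualBasis hB y j) v) := by
  have hE' : ∀ v, euler B hB y d (eta B (contract B B v φ))
      = (2 : ℂ) • eta B (contract B B v φ) := by
    intro v
    rw [euler_eta_contract hB y hy hE]; norm_num
  rw [constTerm_mul_of_euler_eq_two hB y hy (hE' w) (fun j => contract_contract_eq hm _ _)
    (fun j => contract_contract_eq hm _ _) (fun j => Submodule.smul_mem _ _ (hgr (hy j) hw))
    (constTerm_eq_zero_of_euler hB y two_ne_zero (hE' v)), Finset.mul_sum, Finset.mul_sum]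
  refine Finset.sum_congr rfl fun j _ => ?_
  simp only [map_smul, LinearMap.smul_apply, smul_eq_mul]
  ring


include hE hm hgr in
-- Exchanging $y_j$ with $y^j$ and then using super-symmetry of the form interchanges the roles of
-- $v$ and $w$. This removes the constant term from the second contraction of $\varphi^2$.
theorem constTerm_contract_mul_contract_comm {a b : ZMod 2} {v w : V} (hv : v ∈ 𝒱 a)
    (hw : w ∈ 𝒱 b) :
    ksign b a * constTerm B (contract B B v φ * contract B B w φ)
      = constTerm B (contract B B w φ * contract B B v φ) := by
  have hD := dualBasis_mem B hB y d hy
  rw [constTerm_contract_mul_contract hB y hy hm hgr hE v hw,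
    constTerm_contract_mul_contract hB y hy hm hgr hE w hv]
  have h := sum_dualBasis_swap B hB y hy (fun c => ksign c a)
    (B.form.compl₁₂ (m.flip v) (m.flip w))
  simp only [LinearMap.compl₁₂_apply, LinearMap.flip_apply, smul_eq_mul] at h
  rw [h, mul_left_comm, Finset.mul_sum (a := ksign b a)]
  congr 1
  refine Finset.sum_congr rfl fun j _ => ?_
  have h1 := hgr (hD j) hv
  have h2 := hgr (hy j) hw
  rw [B.supersymm h1 h2]
  rcases B.eq_zero_or_eq h2 h1 with h | h
  · simp [h]
  · rw [add_left_cancel h]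
    have k : ∀ a c : ZMod 2,
        ksign a a * (ksign c a * ksign c c * ksign (c + a) (c + a)) = ksign c a := by
      intro a c
      fin_cases a <;> fin_cases c <;> simp +decide [ksign]
    linear_combination B.form (m (y j) w) (m (B.form.dualBasis hB y j) v) * k a (d j)

include hB hy hodd hE hm hgr in
theorem constTerm_contract_contract_sq {a b : ZMod 2} {v w : V} (hv : v ∈ 𝒱 a) (hw : w ∈ 𝒱 b) :
    constTerm B (contract B B w (contract B B v (φ * φ))) = 0 := by
  have h0 : constTerm B (contract B B (m w v) φ) = 0 :=
    constTerm_eq_zero_of_euler hB y (k := 3 - 1) (by norm_num) (euler_eta_contract hB y hy hE _)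
  rw [contract_contract_sq hodd hm hgr hv hw, map_sub, map_add, map_smul, h0, smul_eq_mul,
    constTerm_contract_mul_contract_comm hB y hy hm hgr hE hv hw]
  ring

include hodd hE hm hgr in
-- The Euler formula writes $3\varphi$ as $\sum\pm y^i\,\iota(y_i)\varphi$ minus a vector, and a
-- vector times $\varphi$ has no constant term. Turning the leading $y^i$ into a contraction leaves
-- products of two quadratic elements, so $\frac1{24}=\frac13\cdot\frac18$.
theorem constTerm_cubic_sq :
    constTerm B (φ * φ) = -(1 / 24) * ∑ i, ∑ j, ksign (d j) (d i) *
      B.form (m (y j) (y i)) (m (B.form.dualBasis hB y j) (B.form.dualBasis hB y i)) := by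
  have hD := dualBasis_mem B hB y d hy
  have h0 : ∀ v, constTerm B (ι 𝒱 B v * φ) = 0 := fun v => by
    rw [constTerm_ι_mul]
    exact constTerm_eq_zero_of_euler hB y (k := 3 - 1) (by norm_num)
      (euler_eta_contract hB y hy hE _)
  have h1 := sum_ι_mul_contract hB y (d := d) φ
  rw [hE, map_smul, LinearEquiv.symm_apply_apply] at h1
  simp_rw [contract_contract_eq hm] at h1
  have h2 := congrArg (fun w => constTerm B (w * φ)) h1
  simp only [Finset.sum_mul, add_mul, smul_mul_assoc, map_add, map_smul, map_sum, h0,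
    mul_zero, Finset.sum_const_zero, add_zero, smul_eq_mul] at h2
  have h3 : ∀ i, ksign (d i) (d i) *
      constTerm B (ι 𝒱 B (B.form.dualBasis hB y i) * contract B B (y i) φ * φ)
      = constTerm B (contract B B (y i) φ * contract B B (B.form.dualBasis hB y i) φ) := by
    intro i
    rw [mul_assoc, constTerm_ι_mul, contract_mul (hD i), contract_contract_eq hm, map_add, h0,
      signAut_contract_of_odd hodd _ (hy i), smul_mul_assoc, map_smul, smul_eq_mul, zero_add,
      ← mul_assoc, ksign_mul_self, one_mul]
  simp_rw [h3, fun i => constTerm_contract_mul_contract hB y hy hm hgr hE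
    (B.form.dualBasis hB y i) (hy i)] at h2
  rw [← Finset.mul_sum] at h2
  linear_combination -(1 / 3) * h2

end Cubic

end SuperClifford

section

open SuperClifford SuperExterior

variable {r p : Type*} [AddCommGroup r] [Module ℂ r] [AddCommGroup p] [Module ℂ p]
  {𝓇 : ZMod 2 → Submodule ℂ r} {𝓅 : ZMod 2 → Submodule ℂ p} [DirectSum.Decomposition 𝓇]
  [DirectSum.Decomposition 𝓅]
  {br : r →ₗ[ℂ] r →ₗ[ℂ] r} {Br : SuperForm 𝓇} {Bp : SuperForm 𝓅} {ν : r →ₗ[ℂ] Module.End ℂ p}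
  {m n : Type*} [Fintype m] [DecidableEq m] [Fintype n] [DecidableEq n]

/-! ### The quadratic elements $\nu_*(x)$. -/

section NuStar

variable (hν : IsOspRepresentation 𝓇 𝓅 br Bp ν) (hBp : Bp.form.Nondegenerate)
  (y : Module.Basis n ℂ p) {d : n → ZMod 2} (hy : ∀ i, y i ∈ 𝓅 (d i)) {a : ZMod 2} {x : r}
  (hx : x ∈ 𝓇 a)
include hν hy hx

omit [DirectSum.Decomposition 𝓇] in
-- A coefficient $(\nu(x)y_i,y_j)$ vanishes unless $|y_j|=|x|+|y_i|$, and then $y^i\wedge y^j$ has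
-- parity $|x|$.
theorem nuStar_mem_gradedPart : nuStar ν Bp hBp y d x ∈ gradedPart 𝓅 2 a := by
  refine Submodule.smul_mem _ _ (Submodule.sum_mem _ fun i _ => Submodule.sum_mem _ fun j _ => ?_)
  rcases Bp.eq_zero_or_eq (hν.grading hx (hy i)) (hy j) with h | h
  · simp [h]
  · refine Submodule.smul_mem _ _ (Submodule.subset_span ⟨![d i, d j],
      ![Bp.form.dualBasis hBp y i, Bp.form.dualBasis hBp y j], ?_, ?_, ?_⟩)
    · intro k
      fin_cases k
      · exact dualBasis_mem Bp hBp y d hy i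
      · exact dualBasis_mem Bp hBp y d hy j
    · rw [Fin.sum_univ_two]
      change d i + d j = a
      rw [← h, add_comm a, ← add_assoc, CharTwo.add_self_eq_zero, zero_add]
    · simp [List.ofFn_succ]

omit [DirectSum.Decomposition 𝓇] in
theorem signAut_nuStar (b : ZMod 2) :
    signAut Bp b ((eta Bp).symm (nuStar ν Bp hBp y d x))
      = ksign b a • (eta Bp).symm (nuStar ν Bp hBp y d x) := by
  apply (eta Bp).injective
  rw [eta_signAut, map_smul, LinearEquiv.apply_symm_apply,
    signAut_of_mem_gradedPart (nuStar_mem_gradedPart hν hBp y hy hx)]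
  simp

omit [DirectSum.Decomposition 𝓇] in
theorem euler_nuStar :
    euler Bp hBp y d (nuStar ν Bp hBp y d x) = (2 : ℂ) • nuStar ν Bp hBp y d x := by
  simpa using euler_of_mem_gradedPart Bp hBp y hy (nuStar_mem_gradedPart hν hBp y hy hx)

omit [DirectSum.Decomposition 𝓇] in
-- The super commutator of $\nu_*(x)$ and $w$ is $\nu(x)w$ by definition, and it is also twice a
-- contraction up to sign.
theorem contract_nuStar {b : ZMod 2} {w : p} (hw : w ∈ 𝓅 b) :
    contract Bp Bp w ((eta Bp).symm (nuStar ν Bp hBp y d x))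
      = ι 𝓅 Bp (-((1 / 2 : ℂ) * ksign a b) • ν x w) := by
  have h1 := ι_mul_sub hw ((eta Bp).symm (nuStar ν Bp hBp y d x))
  have h2 := nuStar_commutator hν hBp y d hy hx hw
  rw [signAut_nuStar hν hBp y hy hx] at h1
  rw [map_smul, ← h2, smul_sub, smul_smul, neg_mul, mul_assoc, ksign_mul_self]
  have h3 : contract Bp Bp w ((eta Bp).symm (nuStar ν Bp hBp y d x))
      = (1 / 2 : ℂ) • (2 : ℂ) • contract Bp Bp w ((eta Bp).symm (nuStar ν Bp hBp y d x)) := by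
    rw [smul_smul]; norm_num
  rw [h3, ← h1, ksign_comm b a, smul_mul_assoc]
  module

omit [DirectSum.Decomposition 𝓇] in
theorem nuStar_mul_ι {b : ZMod 2} {w : p} (hw : w ∈ 𝓅 b) :
    (eta Bp).symm (nuStar ν Bp hBp y d x) * ι 𝓅 Bp w
      = ksign a b • (ι 𝓅 Bp w * (eta Bp).symm (nuStar ν Bp hBp y d x)) + ι 𝓅 Bp (ν x w) := by
  rw [← nuStar_commutator hν hBp y d hy hx hw]
  abel

end NuStar

/-! ### The image of the Casimir element and its contractions. -/

section Casimir

/-- The Casimir operator `∑ ν(xᵢ) ν(xⁱ)` on a representation. -/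
def casimirEnd (ν : r →ₗ[ℂ] Module.End ℂ p) (Br : SuperForm 𝓇) (hBr : Br.form.Nondegenerate)
    (x : Module.Basis m ℂ r) : Module.End ℂ p :=
  ∑ i, ν (x i) * ν (Br.form.dualBasis hBr x i)

omit [DirectSum.Decomposition 𝓇] in
theorem casimirEnd_apply (hBr : Br.form.Nondegenerate) (x : Module.Basis m ℂ r) (w : p) :
    casimirEnd ν Br hBr x w = ∑ i, ν (x i) (ν (Br.form.dualBasis hBr x i) w) := by
  simp [casimirEnd, LinearMap.sum_apply]

variable (hν : IsOspRepresentation 𝓇 𝓅 br Bp ν) (hBr : Br.form.Nondegenerate)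
  (hBp : Bp.form.Nondegenerate)
  (x : Module.Basis m ℂ r) {e : m → ZMod 2} (hx : ∀ i, x i ∈ 𝓇 (e i))
  (y : Module.Basis n ℂ p) {d : n → ZMod 2} (hy : ∀ i, y i ∈ 𝓅 (d i))

include hν hx in
omit [DirectSum.Decomposition 𝓅] in
-- Moving the two operators across the form gives two minus signs and reverses their order; the
-- reversed tensor $\sum x^i\otimes x_i$ is again the canonical one up to sign.
theorem form_casimirEnd {a b : ZMod 2} {v w : p} (hv : v ∈ 𝓅 a) (hw : w ∈ 𝓅 b) :
    Bp.form w (casimirEnd ν Br hBr x v) = ksign b a * Bp.form v (casimirEnd ν Br hBr x w) := by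
  have hD := dualBasis_mem Br hBr x e hx
  have hC : casimirEnd ν Br hBr x v ∈ 𝓅 a := by
    rw [casimirEnd_apply]
    refine Submodule.sum_mem _ fun i _ => ?_
    have := hν.grading (hx i) (hν.grading (hD i) hv)
    rwa [← add_assoc, CharTwo.add_self_eq_zero, zero_add] at this
  rw [Bp.supersymm hw hC]
  congr 1
  have h := sum_dualBasis_swap Br hBr x hx (fun _ => 1)
    (LinearMap.mk₂ ℂ (fun s t => Bp.form v (ν s (ν t w))) (by simp) (by simp) (by simp) (by simp))
  simp only [LinearMap.mk₂_apply, one_mul, smul_eq_mul] at h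
  rw [casimirEnd_apply, casimirEnd_apply, map_sum, map_sum, h, LinearMap.sum_apply]
  refine Finset.sum_congr rfl fun i _ => ?_
  have h1 := hν.osp (hx i) (hν.grading (hD i) hv) w
  have h2 := hν.osp (hD i) hv (ν (x i) w)
  rw [ksign_add_right] at h1
  linear_combination h1 - ksign (e i) (e i) * ksign (e i) a * h2 +
    ksign (e i) (e i) * Bp.form v (ν (Br.form.dualBasis hBr x i) (ν (x i) w)) *
      ksign_mul_self (e i) a

omit [DirectSum.Decomposition 𝓇] in
theorem nuStarLift_casimirTensor (νs : r →ₗ[ℂ] SuperExterior 𝓅) :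
    nuStarLift Bp νs (casimirTensor Br.form hBr x)
      = ∑ i, (eta Bp).symm (νs (x i)) * (eta Bp).symm (νs (Br.form.dualBasis hBr x i)) := by
  simp [nuStarLift, casimirTensor, TensorAlgebra.lift_ι_apply]

include hν hx hy in
-- The two sums of the Leibniz rule agree after exchanging dual bases, once $\nu_*(x_i)$ is moved to
-- the right of the vector $\nu(x^i)v$. The commutators arising from this add up to the Casimir
-- operator.
theorem contract_casimir {a : ZMod 2} {v : p} (hv : v ∈ 𝓅 a) :
    contract Bp Bp v (nuStarLift Bp (nuStar ν Bp hBp y d) (casimirTensor Br.form hBr x))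
      = -∑ i, ksign (e i) a • (ι 𝓅 Bp (ν (x i) v) * (eta Bp).symm (nuStar ν Bp hBp y d
          (Br.form.dualBasis hBr x i)))
        - ι 𝓅 Bp ((1 / 2 : ℂ) • casimirEnd ν Br hBr x v) := by
  have hD := dualBasis_mem Br hBr x e hx
  have h1 : ∀ i, contract Bp Bp v ((eta Bp).symm (nuStar ν Bp hBp y d (x i)) *
      (eta Bp).symm (nuStar ν Bp hBp y d (Br.form.dualBasis hBr x i)))
      = -(1 / 2 : ℂ) • (ksign (e i) a • (ι 𝓅 Bp (ν (x i) v) *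
          (eta Bp).symm (nuStar ν Bp hBp y d (Br.form.dualBasis hBr x i))))
        - (1 / 2 : ℂ) • ((ksign (e i) a * ksign (e i) (e i)) •
          (ι 𝓅 Bp (ν (Br.form.dualBasis hBr x i) v) * (eta Bp).symm (nuStar ν Bp hBp y d (x i))))
        - (1 / 2 : ℂ) • ι 𝓅 Bp (ν (x i) (ν (Br.form.dualBasis hBr x i) v)) := by
    intro i
    rw [contract_mul hv, contract_nuStar hν hBp y hy (hx i) hv,
      contract_nuStar hν hBp y hy (hD i) hv, signAut_nuStar hν hBp y hy (hx i), map_smul,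
      map_smul, smul_mul_assoc, smul_mul_smul_comm,
      nuStar_mul_ι hν hBp y hy (hx i) (hν.grading (hD i) hv), ksign_add_right, ksign_comm a]
    have : ksign (e i) a * -(1 / 2 * ksign (e i) a) = -(1 / 2 : ℂ) := by
      linear_combination -(1 / 2) * ksign_mul_self (e i) a
    rw [this]
    module
  have h2 := sum_dualBasis_swap Br hBr x hx (fun c => ksign c a)
    ((LinearMap.mul ℂ (SuperClifford 𝓅 Bp)).compl₁₂ (ι 𝓅 Bp ∘ₗ ν.flip v)
      ((eta Bp).symm.toLinearMap ∘ₗ nuStar ν Bp hBp y d))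
  simp only [LinearMap.compl₁₂_apply, LinearMap.mul_apply', LinearMap.comp_apply,
    LinearMap.flip_apply, LinearEquiv.coe_coe] at h2
  rw [nuStarLift_casimirTensor, map_sum, Finset.sum_congr rfl fun i _ => h1 i,
    Finset.sum_sub_distrib, Finset.sum_sub_distrib, ← Finset.smul_sum, ← Finset.smul_sum,
    ← Finset.smul_sum, ← h2, casimirEnd_apply, ← map_sum, map_smul]
  module

-- In the application `ρ` is the $\mathfrak r$-component of the bracket on $\mathfrak p$, and `hρ`
-- is invariance of the form on $\mathfrak g$.
variable {ρ : p →ₗ[ℂ] p →ₗ[ℂ] r}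
  (hρ : ∀ ⦃a c : ZMod 2⦄ ⦃s : r⦄ ⦃v : p⦄, s ∈ 𝓇 c → v ∈ 𝓅 a → ∀ w : p,
    Br.form (ρ w v) s = -(ksign c a * Bp.form w (ν s v)))
  (hρg : ∀ ⦃a b : ZMod 2⦄ ⦃v w : p⦄, v ∈ 𝓅 a → w ∈ 𝓅 b → ρ v w ∈ 𝓇 (a + b))

include hρ hx in
omit [DirectSum.Decomposition 𝓇] [DirectSum.Decomposition 𝓅] in
theorem sum_form_smul_eq_neg {a : ZMod 2} {v : p} (hv : v ∈ 𝓅 a) (w : p) {M : Type*}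
    [AddCommGroup M] [Module ℂ M] (f : r →ₗ[ℂ] M) :
    ∑ i, (ksign (e i) a * Bp.form w (ν (x i) v)) • f (Br.form.dualBasis hBr x i)
      = -f (ρ w v) := by
  conv_rhs => rw [← sum_form_smul_dualBasis Br hBr x (ρ w v)]
  rw [map_sum, ← Finset.sum_neg_distrib]
  refine Finset.sum_congr rfl fun i _ => ?_
  rw [map_smul, hρ (hx i) hv, neg_smul, neg_neg]

include hν hx hy hρ in
-- The scalars $(w,\nu(x_i)v)$ are, up to sign, the coordinates of $\rho(w,v)$, so the terms
-- containing them assemble into $\nu_*(\rho(w,v))$.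
theorem contract_contract_casimir {a b : ZMod 2} {v w : p} (hv : v ∈ 𝓅 a) (hw : w ∈ 𝓅 b) :
    contract Bp Bp w (contract Bp Bp v
        (nuStarLift Bp (nuStar ν Bp hBp y d) (casimirTensor Br.form hBr x)))
      = (eta Bp).symm (nuStar ν Bp hBp y d (ρ w v)) - (1 / 2 * ksign b a : ℂ) • ∑ i, ksign (e i) a •
          (ι 𝓅 Bp (ν (x i) v) * ι 𝓅 Bp (ν (Br.form.dualBasis hBr x i) w))
        - (1 / 2 * Bp.form w (casimirEnd ν Br hBr x v) : ℂ) • 1 := by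
  have hD := dualBasis_mem Br hBr x e hx
  have h1 : ∀ i, contract Bp Bp w
      (ksign (e i) a • (ι 𝓅 Bp (ν (x i) v) * (eta Bp).symm (nuStar ν Bp hBp y d
          (Br.form.dualBasis hBr x i))))
      = (ksign (e i) a * Bp.form w (ν (x i) v)) • (eta Bp).symm (nuStar ν Bp hBp y d
          (Br.form.dualBasis hBr x i))
        + (1 / 2 * ksign b a : ℂ) • ksign (e i) a •
          (ι 𝓅 Bp (ν (x i) v) * ι 𝓅 Bp (ν (Br.form.dualBasis hBr x i) w)) := by
    intro i
    rw [map_smul, contract_ι_mul Bp Bp hw (hν.grading (hx i) hv),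
      contract_nuStar hν hBp y hy (hD i) hw, map_smul, mul_smul_comm, ksign_add_right,
      ksign_comm b (e i), smul_sub, smul_smul (ksign _ _ * _)]
    have : ksign (e i) b * ksign b a * -(1 / 2 * ksign (e i) b) = -(1 / 2 * ksign b a : ℂ) := by
      linear_combination -(1 / 2) * ksign b a * ksign_mul_self (e i) b
    rw [this]
    module
  have h2 := sum_form_smul_eq_neg hBr x hx hρ hv w
    ((eta Bp).symm.toLinearMap ∘ₗ nuStar ν Bp hBp y d)
  simp only [LinearMap.comp_apply, LinearEquiv.coe_coe] at h2
  rw [contract_casimir hν hBr hBp x hx y hy hv, map_sub, map_neg, map_sum,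
    Finset.sum_congr rfl fun i _ => h1 i, Finset.sum_add_distrib, h2, contract_ι,
    ← Finset.smul_sum, Algebra.algebraMap_eq_smul_one, map_smul, smul_eq_mul]
  module

include hν hx hy hρ hρg in
-- The term $\nu_*(\rho(w,v))$ has degree two. The other two contribute multiples of $(v,Cw)$ and
-- $(w,Cv)$, which cancel because the Casimir operator $C$ is self-adjoint.
theorem constTerm_contract_contract_casimir {a b : ZMod 2} {v w : p} (hv : v ∈ 𝓅 a)
    (hw : w ∈ 𝓅 b) : constTerm Bp (contract Bp Bp w (contract Bp Bp v
        (nuStarLift Bp (nuStar ν Bp hBp y d) (casimirTensor Br.form hBr x)))) = 0 := by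
  have h0 : constTerm Bp ((eta Bp).symm (nuStar ν Bp hBp y d (ρ w v))) = 0 := by
    refine constTerm_eq_zero_of_euler hBp y (d := d) two_ne_zero ?_
    rw [LinearEquiv.apply_symm_apply]
    exact euler_nuStar hν hBp y hy (hρg hw hv)
  have h1 : ∀ i, ksign (e i) a • constTerm Bp
      (ι 𝓅 Bp (ν (x i) v) * ι 𝓅 Bp (ν (Br.form.dualBasis hBr x i) w))
      = -Bp.form v (ν (x i) (ν (Br.form.dualBasis hBr x i) w)) := by
    intro i
    rw [constTerm_ι_mul_ι, smul_eq_mul]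
    linear_combination ksign (e i) a * hν.osp (hx i) hv (ν (Br.form.dualBasis hBr x i) w) -
      Bp.form v (ν (x i) (ν (Br.form.dualBasis hBr x i) w)) * ksign_mul_self (e i) a
  rw [contract_contract_casimir hν hBr hBp x hx y hy hρ hv hw, map_sub, map_sub, map_smul,
    map_sum]
  simp_rw [map_smul, h1]
  rw [h0, constTerm_one, Finset.sum_neg_distrib, ← map_sum, ← casimirEnd_apply,
    form_casimirEnd hν hBr x hx hv hw, smul_eq_mul, smul_eq_mul]
  ring

include hν hx hy hρ hρg in
-- Each remaining sum is again an expansion of a value of `ρ`. What is left are the terms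
-- $\nu(\rho(\cdot,\cdot))\,\cdot$ of the Jacobi identity, the counterpart of the triple contraction
-- of $\varphi^2$.
theorem contract_contract_contract_casimir {a b c : ZMod 2} {u v w : p} (hv : v ∈ 𝓅 a)
    (hw : w ∈ 𝓅 b) (hu : u ∈ 𝓅 c) :
    contract Bp Bp u (contract Bp Bp w (contract Bp Bp v
        (nuStarLift Bp (nuStar ν Bp hBp y d) (casimirTensor Br.form hBr x))))
      = ι 𝓅 Bp ((1 / 2 : ℂ) • (-(ksign (b + a) c • ν (ρ w v) u) + ksign b a • ν (ρ u v) w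
        - ν (ρ u w) v)) := by
  have hD := dualBasis_mem Br hBr x e hx
  have h1 : ∀ i, contract Bp Bp u (ksign (e i) a •
      (ι 𝓅 Bp (ν (x i) v) * ι 𝓅 Bp (ν (Br.form.dualBasis hBr x i) w)))
      = (ksign (e i) a * Bp.form u (ν (x i) v)) • ι 𝓅 Bp (ν (Br.form.dualBasis hBr x i) w)
        - (ksign (e i) a * ksign c (e i + a)) • Bp.form u (ν (Br.form.dualBasis hBr x i) w) •
          ι 𝓅 Bp (ν (x i) v) := by
    intro i
    rw [map_smul, contract_ι_mul Bp Bp hu (hν.grading (hx i) hv), contract_ι,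
      Algebra.algebraMap_eq_smul_one, mul_smul_comm, mul_one]
    module
  have h2 := sum_dualBasis_swap Br hBr x hx (fun t => ksign t a * ksign c (t + a))
    (LinearMap.mk₂ ℂ (fun s t => Bp.form u (ν t w) • ι 𝓅 Bp (ν s v)) (by simp)
      (fun c s t => by simp only [map_smul, LinearMap.smul_apply]; rw [smul_comm])
      (by simp [add_smul]) (by simp [mul_smul]))
  simp only [LinearMap.mk₂_apply] at h2
  have h3 : ∀ i, (ksign (e i) a * ksign c (e i + a) * ksign (e i) (e i)) •
      Bp.form u (ν (x i) w) • ι 𝓅 Bp (ν (Br.form.dualBasis hBr x i) v)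
      = ksign b a • (ksign (e i) b * Bp.form u (ν (x i) w)) •
        ι 𝓅 Bp (ν (Br.form.dualBasis hBr x i) v) := by
    intro i
    rw [smul_smul, smul_smul]
    congr 1
    rcases Bp.eq_zero_or_eq hu (hν.grading (hx i) hw) with h | h
    · simp [h]
    · rw [h]
      have k : ∀ a b t : ZMod 2, ksign t a * ksign (t + b) (t + a) * ksign t t
          = ksign b a * ksign t b := by
        intro a b t
        fin_cases a <;> fin_cases b <;> fin_cases t <;> simp +decide [ksign]
      rw [k, mul_assoc]
  have h4 : ∀ (v w : p) {a : ZMod 2}, v ∈ 𝓅 a → ∑ i, (ksign (e i) a * Bp.form u (ν (x i) v)) •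
      ι 𝓅 Bp (ν (Br.form.dualBasis hBr x i) w) = -ι 𝓅 Bp (ν (ρ u v) w) := fun v w a hv =>
    sum_form_smul_eq_neg hBr x hx hρ hv u (ι 𝓅 Bp ∘ₗ ν.flip w)
  rw [contract_contract_casimir hν hBr hBp x hx y hy hρ hv hw, map_sub, map_sub, map_smul,
    map_sum, Finset.sum_congr rfl fun i _ => h1 i, Finset.sum_sub_distrib, h2,
    Finset.sum_congr rfl fun i _ => h3 i, ← Finset.smul_sum, h4 v w hv, h4 w v hw, map_smul,
    contract_one, contract_nuStar hν hBp y hy (hρg hw hv) hu]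
  have k := ksign_mul_self b a
  simp only [map_smul, map_sub, map_add, map_neg, smul_sub, smul_add, smul_neg, smul_smul,
    mul_assoc, k]
  module

include hν hx hy in
-- Each $\nu_*(x_i)\nu_*(x^i)$ falls under the product formula for $\Lambda^2$, with a factor
-- $\frac12$ from each contraction. The $\mathfrak{osp}$ condition moves $\nu(x_i)$ across the form,
-- and exchanging $y_j$ with $y^j$ produces the supertrace.
theorem constTerm_casimir :
    constTerm Bp (nuStarLift Bp (nuStar ν Bp hBp y d) (casimirTensor Br.form hBr x)) = 1 / 8
        * str 𝓅 (casimirEnd ν Br hBr x) := by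
  have hD := dualBasis_mem Br hBr x e hx
  have hY := dualBasis_mem Bp hBp y d hy
  have h1 : ∀ i, constTerm Bp ((eta Bp).symm (nuStar ν Bp hBp y d (x i)) *
      (eta Bp).symm (nuStar ν Bp hBp y d (Br.form.dualBasis hBr x i)))
      = 1 / 8 * ∑ j, Bp.form (y j)
        (ν (x i) (ν (Br.form.dualBasis hBr x i) (Bp.form.dualBasis hBp y j))) := by
    intro i
    rw [constTerm_mul_of_euler_eq_two hBp y hy (c := e i)
      (g := fun j => -((1 / 2 : ℂ) * ksign (e i) (d j)) • ν (x i) (y j))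
      (f := fun j => -((1 / 2 : ℂ) * ksign (e i) (d j)) •
        ν (Br.form.dualBasis hBr x i) (Bp.form.dualBasis hBp y j)),
      Finset.mul_sum, Finset.mul_sum]
    · refine Finset.sum_congr rfl fun j _ => ?_
      have o := hν.osp (hx i) (hy j)
        (ν (Br.form.dualBasis hBr x i) (Bp.form.dualBasis hBp y j))
      simp only [map_smul, LinearMap.smul_apply, smul_eq_mul, ksign_comm (d j)]
      have k := ksign_mul_self (e i) (d j)
      linear_combination (-1 / 8) * ksign (e i) (d j) * ksign (e i) (d j) * ksign (e i) (d j) * o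
        + 1 / 8 * Bp.form (y j)
          (ν (x i) (ν (Br.form.dualBasis hBr x i) (Bp.form.dualBasis hBp y j))) *
          (ksign (e i) (d j) * ksign (e i) (d j) + 1) * k
    · rw [LinearEquiv.apply_symm_apply]
      exact euler_nuStar hν hBp y hy (hx i)
    · exact fun j => contract_nuStar hν hBp y hy (hx i) (hy j)
    · exact fun j => contract_nuStar hν hBp y hy (hD i) (hY j)
    · intro j
      rw [add_comm]
      exact Submodule.smul_mem _ _ (hν.grading (hx i) (hy j))
    · refine constTerm_eq_zero_of_euler hBp y (d := d) two_ne_zero ?_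
      rw [LinearEquiv.apply_symm_apply]
      exact euler_nuStar hν hBp y hy (hD i)
  have h2 := sum_dualBasis_swap Bp hBp y hy (fun _ => 1)
    (Bp.form.compl₁₂ LinearMap.id (casimirEnd ν Br hBr x))
  simp only [LinearMap.compl₁₂_apply, LinearMap.id_apply, one_mul, smul_eq_mul] at h2
  rw [nuStarLift_casimirTensor, map_sum, Finset.sum_congr rfl fun i _ => h1 i, ← Finset.mul_sum,
    Finset.sum_comm, str_eq_sum Bp hBp y hy, ← h2]
  simp_rw [casimirEnd_apply, map_sum]

end Casimir

end

section

open SuperClifford SuperExterior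

variable {r p : Type*} [AddCommGroup r] [Module ℂ r] [AddCommGroup p] [Module ℂ p]
  {𝓇 : ZMod 2 → Submodule ℂ r} {𝓅 : ZMod 2 → Submodule ℂ p}

/-! ### Projection from $\Lambda(\mathfrak g)$ to $\Lambda(\mathfrak p)$. -/

section Projection

/-- The projection `Λ(g) → Λ(p)`. -/
def extSnd : SuperExterior (prodGrading 𝓇 𝓅) →ₐ[ℂ] SuperExterior 𝓅 :=
  SuperExterior.map (LinearMap.snd ℂ r p) fun _ _ hz => hz.2

@[simp] theorem extSnd_ι (z : r × p) :
    extSnd (ι (prodGrading 𝓇 𝓅) 0 z) = ι 𝓅 0 z.2 := by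
  simp [extSnd, SuperExterior.map]

@[simp] theorem extInl_ι (s : r) :
    extInl (ι 𝓇 0 s) = ι (prodGrading 𝓇 𝓅) 0 (s, 0) := by
  simp [extInl, SuperExterior.map]

@[simp] theorem extInr_ι (v : p) :
    extInr (ι 𝓅 0 v) = ι (prodGrading 𝓇 𝓅) 0 (0, v) := by
  simp [extInr, SuperExterior.map]

variable [DirectSum.Decomposition 𝓅]

theorem extSnd_extInr (w : SuperExterior 𝓅) :
    extSnd (extInr w : SuperExterior (prodGrading 𝓇 𝓅)) = w := by
  have : (extSnd (𝓇 := 𝓇)).toLinearMap ∘ₗ (extInr (𝓇 := 𝓇) (𝓅 := 𝓅)).toLinearMap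
      = LinearMap.id := by
    apply linearMap_ext
    · simp
    · intro a v _ w hw
      simp only [LinearMap.comp_apply, AlgHom.toLinearMap_apply, LinearMap.id_apply] at hw ⊢
      rw [map_mul, map_mul, hw, extInr_ι, extSnd_ι]
  exact LinearMap.congr_fun this w

/-- As $\mathfrak r$ and $\mathfrak p$ are orthogonal, contraction by an element of $\mathfrak p$
sees only $\mathfrak p$-components. -/
theorem extSnd_contract [DirectSum.Decomposition 𝓇] (Br : SuperForm 𝓇) (Bp : SuperForm 𝓅) (v : p)
    (w : SuperExterior (prodGrading 𝓇 𝓅)) :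
    extSnd (contract 0 (prodForm Br Bp) (0, v) w) = contract 0 Bp v (extSnd w) := by
  have : extSnd.toLinearMap ∘ₗ (contract 0 (prodForm Br Bp)).flip w ∘ₗ LinearMap.inr ℂ r p
      = (contract 0 Bp).flip (extSnd w) := by
    refine linearMap_ext_homogeneous (𝒱 := 𝓅) fun a v hv => ?_
    have hv' : ((0, v) : r × p) ∈ prodGrading 𝓇 𝓅 a := ⟨(𝓇 a).zero_mem, hv⟩
    have : extSnd.toLinearMap ∘ₗ contract 0 (prodForm Br Bp) (0, v)
        = contract 0 Bp v ∘ₗ (extSnd (𝓇 := 𝓇)).toLinearMap := by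
      apply linearMap_ext
      · simp
      · intro b z hz w hw
        simp only [LinearMap.comp_apply, AlgHom.toLinearMap_apply] at hw ⊢
        rw [contract_ι_mul _ _ hv' hz, map_sub, map_smul, map_smul, map_mul, map_mul, hw, extSnd_ι,
          contract_ι_mul 0 Bp hv hz.2, prodForm_apply]
        simp
    exact LinearMap.congr_fun this w
  exact LinearMap.congr_fun this v

end Projection

/-- The adjoint action of the Casimir element. -/
theorem adU_casimir {V : Type*} [AddCommGroup V] [Module ℂ V] {𝒱 : ZMod 2 → Submodule ℂ V}
    {n : Type*} [Fintype n] [DecidableEq n] {br : V →ₗ[ℂ] V →ₗ[ℂ] V} (B : SuperForm 𝒱)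
    (hB : B.form.Nondegenerate) (h : IsLieSuperalgebra 𝒱 br) (b : Module.Basis n ℂ V) :
    adU 𝒱 h (casimir 𝒱 br B.form hB b) = casimirEnd (p := V) br B hB b := by
  simp [casimir, adU_mk, casimirTensor, casimirEnd, TensorAlgebra.lift_ι_apply]

/-! ### Components of the bracket of $\mathfrak g=\mathfrak r\oplus\mathfrak p$. -/

section LieSuperType

variable {br : r →ₗ[ℂ] r →ₗ[ℂ] r} {Br : SuperForm 𝓇} {Bp : SuperForm 𝓅}
  {ν : r →ₗ[ℂ] Module.End ℂ p} {brg : (r × p) →ₗ[ℂ] (r × p) →ₗ[ℂ] (r × p)}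

/-- The `p`-component of the bracket of two elements of `p`. -/
def bracketSnd (brg : (r × p) →ₗ[ℂ] (r × p) →ₗ[ℂ] (r × p)) : p →ₗ[ℂ] p →ₗ[ℂ] p :=
  (brg.compl₁₂ (LinearMap.inr ℂ r p) (LinearMap.inr ℂ r p)).compr₂ (LinearMap.snd ℂ r p)

/-- The `r`-component of the bracket of two elements of `p`. -/
def bracketFst (brg : (r × p) →ₗ[ℂ] (r × p) →ₗ[ℂ] (r × p)) : p →ₗ[ℂ] p →ₗ[ℂ] r :=
  (brg.compl₁₂ (LinearMap.inr ℂ r p) (LinearMap.inr ℂ r p)).compr₂ (LinearMap.fst ℂ r p)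

theorem bracket_inr_inr (v w : p) :
    brg (0, v) (0, w) = (bracketFst brg v w, 0) + (0, bracketSnd brg v w) := by
  simp [bracketFst, bracketSnd]

theorem inl_mem_prodGrading {a : ZMod 2} {s : r} (hs : s ∈ 𝓇 a) :
    ((s, 0) : r × p) ∈ prodGrading 𝓇 𝓅 a := ⟨hs, (𝓅 a).zero_mem⟩

theorem inr_mem_prodGrading {a : ZMod 2} {v : p} (hv : v ∈ 𝓅 a) :
    ((0, v) : r × p) ∈ prodGrading 𝓇 𝓅 a := ⟨(𝓇 a).zero_mem, hv⟩

variable (hg : IsLieSuperType br Br Bp ν brg)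
include hg

theorem bracketSnd_mem ⦃a b : ZMod 2⦄ ⦃v w : p⦄ (hv : v ∈ 𝓅 a) (hw : w ∈ 𝓅 b) :
    bracketSnd brg v w ∈ 𝓅 (a + b) :=
  (hg.grading (inr_mem_prodGrading hv) (inr_mem_prodGrading hw)).2

theorem bracketFst_mem ⦃a b : ZMod 2⦄ ⦃v w : p⦄ (hv : v ∈ 𝓅 a) (hw : w ∈ 𝓅 b) :
    bracketFst brg v w ∈ 𝓇 (a + b) :=
  (hg.grading (inr_mem_prodGrading hv) (inr_mem_prodGrading hw)).1

theorem bracketSnd_skew {a b : ZMod 2} {v w : p} (hv : v ∈ 𝓅 a) (hw : w ∈ 𝓅 b) :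
    bracketSnd brg v w = -(ksign a b • bracketSnd brg w v) :=
  congrArg Prod.snd (hg.skew (inr_mem_prodGrading hv) (inr_mem_prodGrading hw))

theorem bracket_inr_inl {a b : ZMod 2} {v : p} {s : r} (hv : v ∈ 𝓅 a) (hs : s ∈ 𝓇 b) :
    brg (0, v) (s, 0) = (0, -(ksign a b • ν s v)) := by
  rw [hg.skew (inr_mem_prodGrading hv) (inl_mem_prodGrading hs), hg.action]
  simp

theorem form_bracketFst ⦃a c : ZMod 2⦄ ⦃s : r⦄ ⦃v : p⦄ (hs : s ∈ 𝓇 c) (hv : v ∈ 𝓅 a) (w : p) :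
    Br.form (bracketFst brg w v) s = -(ksign c a * Bp.form w (ν s v)) := by
  have h := hg.invariant (0, w) (0, v) (s, 0)
  rw [bracket_inr_inl hg hv hs, bracket_inr_inr, prodForm_apply, prodForm_apply] at h
  simpa [ksign_comm] using h

theorem form_bracketFst_right (s : r) (v w : p) :
    Br.form s (bracketFst brg v w) = Bp.form (ν s v) w := by
  have h := hg.invariant (s, 0) (0, v) (0, w)
  rw [hg.action, bracket_inr_inr, prodForm_apply, prodForm_apply] at h
  simpa using h.symm

theorem form_bracketSnd (u v w : p) :
    Bp.form (bracketSnd brg u v) w = Bp.form u (bracketSnd brg v w) := by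
  have h := hg.invariant (0, u) (0, v) (0, w)
  rw [bracket_inr_inr, bracket_inr_inr, prodForm_apply, prodForm_apply] at h
  simpa using h

/-- The `p`-component of the Jacobi identity on `p`. -/
theorem jacobi_snd {a b c : ZMod 2} {u v w : p} (hv : v ∈ 𝓅 a) (hw : w ∈ 𝓅 b) (hu : u ∈ 𝓅 c) :
    bracketSnd brg u (bracketSnd brg w v) - ksign c (b + a) • ν (bracketFst brg w v) u
      = bracketSnd brg (bracketSnd brg u w) v + ν (bracketFst brg u w) v
        + ksign c b • (bracketSnd brg w (bracketSnd brg u v)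
          - ksign b (c + a) • ν (bracketFst brg u v) w) := by
  have h := congrArg Prod.snd (hg.jacobi (inr_mem_prodGrading hu) (inr_mem_prodGrading hw) (0, v))
  rw [bracket_inr_inr w v, bracket_inr_inr u w, bracket_inr_inr u v, map_add, map_add, map_add,
    LinearMap.add_apply, bracket_inr_inl hg hu (bracketFst_mem hg hw hv),
    bracket_inr_inl hg hw (bracketFst_mem hg hu hv), hg.action, bracket_inr_inr, bracket_inr_inr,
    bracket_inr_inr] at h
  simp only [Prod.snd_add, Prod.smul_snd] at h
  simp only [zero_add] at h
  rw [sub_eq_add_neg, sub_eq_add_neg, add_comm (bracketSnd brg u _), h,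
    add_comm (-(ksign b (c + a) • _))]
  abel

omit hg in
-- Every term of $\phi_{\mathfrak r}$ and $\phi_\nu$ has a factor from $\mathfrak r$, so the
-- projection to $\Lambda(\mathfrak p)$ leaves only $\phi_{\mathfrak p}$. The identity passes to
-- $C(\mathfrak p)$ because $\eta$ commutes with contractions.
theorem bracketSnd_eq_of_cubic [DirectSum.Decomposition 𝓇] [DirectSum.Decomposition 𝓅]
    {m : Type*} [Fintype m] [DecidableEq m] (x : Module.Basis m ℂ r) (dx : m → ZMod 2)
    (hBr : Br.form.Nondegenerate) (νs : r →ₗ[ℂ] SuperExterior 𝓅) {φp : SuperExterior 𝓅}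
    (hbr : ∀ z₁ z₂ : r × p, ι (prodGrading 𝓇 𝓅) 0 (brg z₁ z₂) =
      (2 : ℂ) • contract 0 (prodForm Br Bp) z₁ (contract 0 (prodForm Br Bp) z₂
        (extInl (cubicElement br Br hBr x dx) + phiNu Br hBr x νs + extInr φp))) (v w : p) :
    (2 : ℂ) • contract Bp Bp v (contract Bp Bp w ((eta Bp).symm φp))
      = ι 𝓅 Bp (bracketSnd brg v w) := by
  have h := congrArg extSnd (hbr (0, v) (0, w))
  have h1 : extSnd (extInl (cubicElement br Br hBr x dx) : SuperExterior (prodGrading 𝓇 𝓅))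
      = 0 := by
    simp [cubicElement]
  have h2 : extSnd (phiNu Br hBr x νs) = 0 := by
    simp [phiNu]
  rw [map_smul, extSnd_contract, extSnd_contract, map_add extSnd, map_add extSnd, h1, h2,
    extSnd_extInr, zero_add, zero_add, extSnd_ι] at h
  apply (eta Bp).injective
  rw [map_smul, eta_contract, eta_contract, LinearEquiv.apply_symm_apply, eta_ι, ← h]
  rfl

/-! ### The supertrace of the Casimir element of $\mathfrak g$. -/

section Trace

variable [DirectSum.Decomposition 𝓇] [DirectSum.Decomposition 𝓅]
  {m n : Type*} [Fintype m] [DecidableEq m] [Fintype n] [DecidableEq n]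
  (hν : IsOspRepresentation 𝓇 𝓅 br Bp ν)
  (hBr : Br.form.Nondegenerate) (hBp : Bp.form.Nondegenerate)
  (x : Module.Basis m ℂ r) {e : m → ZMod 2} (hx : ∀ i, x i ∈ 𝓇 (e i))
  (y : Module.Basis n ℂ p) {d : n → ZMod 2} (hy : ∀ i, y i ∈ 𝓅 (d i))

omit hg [DirectSum.Decomposition 𝓇] [DirectSum.Decomposition 𝓅] in
theorem dualBasis_prod_inl (hB : (prodForm Br Bp).form.Nondegenerate) (i : m) :
    (prodForm Br Bp).form.dualBasis hB (x.prod y) (Sum.inl i)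
      = (Br.form.dualBasis hBr x i, 0) := by
  rw [← sum_form_smul_dualBasis (prodForm Br Bp) hB (x.prod y) (Br.form.dualBasis hBr x i, 0)]
  simp [prodForm_apply, LinearMap.BilinForm.apply_dualBasis_left]

omit hg [DirectSum.Decomposition 𝓇] [DirectSum.Decomposition 𝓅] in
theorem dualBasis_prod_inr (hB : (prodForm Br Bp).form.Nondegenerate) (j : n) :
    (prodForm Br Bp).form.dualBasis hB (x.prod y) (Sum.inr j)
      = (0, Bp.form.dualBasis hBp y j) := by
  rw [← sum_form_smul_dualBasis (prodForm Br Bp) hB (x.prod y) (0, Bp.form.dualBasis hBp y j)]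
  simp [prodForm_apply, LinearMap.BilinForm.apply_dualBasis_left]

include hν hx hy in
-- The block of $\sum_j y_jy^j$ on $\mathfrak r$. Invariance rewrites its diagonal entries as
-- entries of $\nu(x^i)\nu(x_i)$ on $\mathfrak p$.
theorem sum_form_bracketFst : ∑ j, ∑ i, ksign (e i) (e i) *
      (prodForm Br Bp).form (Br.form.dualBasis hBr x i, 0)
        (brg (0, y j) (brg (0, Bp.form.dualBasis hBp y j) (x i, 0)))
      = str 𝓅 (casimirEnd ν Br hBr x) := by
  have hX := dualBasis_mem Br hBr x e hx
  have hY := dualBasis_mem Bp hBp y d hy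
  have h1 : ∀ j i, ksign (e i) (e i) * (prodForm Br Bp).form (Br.form.dualBasis hBr x i, 0)
        (brg (0, y j) (brg (0, Bp.form.dualBasis hBp y j) (x i, 0)))
      = ksign (e i) (e i) * Bp.form (y j)
        (ν (Br.form.dualBasis hBr x i) (ν (x i) (Bp.form.dualBasis hBp y j))) := by
    intro j i
    have o := hν.osp (hX i) (hy j) (ν (x i) (Bp.form.dualBasis hBp y j))
    rw [bracket_inr_inl hg (hY j) (hx i), bracket_inr_inr, prodForm_apply]
    simp only [Prod.fst_add, Prod.snd_add, add_zero, map_neg, map_smul, smul_eq_mul, map_zero,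
      LinearMap.zero_apply, form_bracketFst_right hg, ksign_comm (d j)]
    linear_combination -ksign (e i) (e i) * ksign (e i) (d j) * o + ksign (e i) (e i) *
      Bp.form (y j) (ν (Br.form.dualBasis hBr x i) (ν (x i) (Bp.form.dualBasis hBp y j))) *
      ksign_mul_self (e i) (d j)
  have h2 : ∀ j, ∑ i, ksign (e i) (e i) * Bp.form (y j)
        (ν (Br.form.dualBasis hBr x i) (ν (x i) (Bp.form.dualBasis hBp y j)))
      = Bp.form (y j) (casimirEnd ν Br hBr x (Bp.form.dualBasis hBp y j)) := by
    intro j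
    have h := sum_dualBasis_swap Br hBr x hx (fun _ => 1)
      (LinearMap.mk₂ ℂ (fun s t => Bp.form (y j) (ν s (ν t (Bp.form.dualBasis hBp y j))))
        (by simp) (by simp) (by simp) (by simp))
    simp only [LinearMap.mk₂_apply, one_mul, smul_eq_mul] at h
    rw [← h, casimirEnd_apply, map_sum]
  have h3 := sum_dualBasis_swap Bp hBp y hy (fun _ => 1)
    (Bp.form.compl₁₂ LinearMap.id (casimirEnd ν Br hBr x))
  simp only [LinearMap.compl₁₂_apply, LinearMap.id_apply, one_mul, smul_eq_mul] at h3
  simp_rw [h1, h2]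
  rw [str_eq_sum Bp hBp y hy, ← h3]

include hν hx hy in
-- The part of $\sum_j y_jy^j$ on $\mathfrak p$ that passes through $\mathfrak r$. Expanding
-- $[y^j,y_i]_{\mathfrak r}$ in the basis of $\mathfrak r$ allows the sum over $i$ to be done by
-- completeness.
theorem sum_form_action_bracketFst : ∑ j, ∑ i, ksign (d i) (d i) *
      Bp.form (Bp.form.dualBasis hBp y i) (-(ksign (d j) (d j + d i) •
        ν (bracketFst brg (Bp.form.dualBasis hBp y j) (y i)) (y j)))
      = str 𝓅 (casimirEnd ν Br hBr x) := by
  have hX := dualBasis_mem Br hBr x e hx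
  have hY := dualBasis_mem Bp hBp y d hy
  have h1 : ∀ j i, ksign (d i) (d i) *
      Bp.form (Bp.form.dualBasis hBp y i) (-(ksign (d j) (d j + d i) •
        ν (bracketFst brg (Bp.form.dualBasis hBp y j) (y i)) (y j)))
      = ∑ l, ksign (d j) (d j) * (Bp.form (Bp.form.dualBasis hBp y i)
          (ν (Br.form.dualBasis hBr x l) (y j)) *
            Bp.form (Bp.form.dualBasis hBp y j) (ν (x l) (y i))) := by
    intro j i
    have h := sum_form_smul_eq_neg hBr x hx (form_bracketFst hg) (hy i)
      (Bp.form.dualBasis hBp y j) (Bp.form (Bp.form.dualBasis hBp y i) ∘ₗ ν.flip (y j))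
    simp only [LinearMap.comp_apply, LinearMap.flip_apply, smul_eq_mul] at h
    rw [map_neg, map_smul, smul_eq_mul, ← mul_neg, ← h, Finset.mul_sum, Finset.mul_sum]
    refine Finset.sum_congr rfl fun l _ => ?_
    rcases Bp.eq_zero_or_eq (hY j) (hν.grading (hx l) (hy i)) with h | h
    · simp [h]
    · rw [h]
      have k : ∀ a t : ZMod 2, ksign a a * (ksign (t + a) (t + a + a) * ksign t a)
          = ksign (t + a) (t + a) := by
        intro a t
        fin_cases a <;> fin_cases t <;> simp +decide [ksign]
      rw [← k]
      ring
  have h2 : ∀ j l, ∑ i, Bp.form (Bp.form.dualBasis hBp y i)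
      (ν (Br.form.dualBasis hBr x l) (y j)) * Bp.form (Bp.form.dualBasis hBp y j) (ν (x l) (y i))
      = Bp.form (Bp.form.dualBasis hBp y j) (ν (x l) (ν (Br.form.dualBasis hBr x l) (y j))) := by
    intro j l
    conv_rhs => rw [← sum_form_dualBasis_smul Bp hBp y (ν (Br.form.dualBasis hBr x l) (y j))]
    simp only [map_sum, map_smul, smul_eq_mul]
  rw [str_eq_sum Bp hBp y hy]
  refine Finset.sum_congr rfl fun j _ => ?_
  simp_rw [h1 j]
  rw [Finset.sum_comm]
  simp_rw [← Finset.mul_sum, h2]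
  rw [casimirEnd_apply, map_sum]

include hy in
omit [DirectSum.Decomposition 𝓇] in
-- The part of $\sum_j y_jy^j$ on $\mathfrak p$ that stays in $\mathfrak p$. The minus sign is the
-- skew-symmetry used after invariance.
theorem sum_form_bracketSnd : ∑ j, ∑ i, ksign (d i) (d i) * Bp.form (Bp.form.dualBasis hBp y i)
        (bracketSnd brg (y j) (bracketSnd brg (Bp.form.dualBasis hBp y j) (y i)))
      = -∑ j, ∑ i, ksign (d j) (d i) * Bp.form (bracketSnd brg (y j) (y i))
          (bracketSnd brg (Bp.form.dualBasis hBp y j) (Bp.form.dualBasis hBp y i)) := by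
  have hY := dualBasis_mem Bp hBp y d hy
  rw [← Finset.sum_neg_distrib]
  refine Finset.sum_congr rfl fun j _ => ?_
  have h := sum_dualBasis_swap Bp hBp y hy (fun t => ksign (d j) t)
    (Bp.form.compl₁₂ (bracketSnd brg (y j)) (bracketSnd brg (Bp.form.dualBasis hBp y j)))
  simp only [LinearMap.compl₁₂_apply, smul_eq_mul] at h
  rw [h, ← Finset.sum_neg_distrib]
  refine Finset.sum_congr rfl fun i _ => ?_
  rw [← form_bracketSnd hg, bracketSnd_skew hg (hY i) (hy j), ksign_comm (d i) (d j)]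
  simp only [map_neg, map_smul, LinearMap.neg_apply, LinearMap.smul_apply, smul_eq_mul]
  ring

include hν hx hy in
/-- The supertrace of the Casimir operator of `g = r ⊕ p` in the adjoint representation. -/
theorem str_casimirEnd_prod (hB : (prodForm Br Bp).form.Nondegenerate) :
    str (prodGrading 𝓇 𝓅) (casimirEnd (p := r × p) brg (prodForm Br Bp) hB (x.prod y))
      = str 𝓇 (casimirEnd (p := r) br Br hBr x) + 3 * str 𝓅 (casimirEnd ν Br hBr x)
        - ∑ j, ∑ i, ksign (d j) (d i) * Bp.form (bracketSnd brg (y j) (y i))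
          (bracketSnd brg (Bp.form.dualBasis hBp y j) (Bp.form.dualBasis hBp y i)) := by
  have hX := dualBasis_mem Br hBr x e hx
  have hY := dualBasis_mem Bp hBp y d hy
  have hxy : ∀ k, (x.prod y) k ∈ prodGrading 𝓇 𝓅 (Sum.elim e d k) := by
    rintro (i | j)
    · simpa using inl_mem_prodGrading (hx i)
    · simpa using inr_mem_prodGrading (hy j)
  have h1 : ∀ j i, ksign (d i) (d i) * (prodForm Br Bp).form (0, Bp.form.dualBasis hBp y i)
        (brg (0, y j) (brg (0, Bp.form.dualBasis hBp y j) (0, y i)))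
      = ksign (d i) (d i) * Bp.form (Bp.form.dualBasis hBp y i)
          (bracketSnd brg (y j) (bracketSnd brg (Bp.form.dualBasis hBp y j) (y i)))
        + ksign (d i) (d i) * Bp.form (Bp.form.dualBasis hBp y i) (-(ksign (d j) (d j + d i) •
        ν (bracketFst brg (Bp.form.dualBasis hBp y j) (y i)) (y j))) := by
    intro j i
    rw [bracket_inr_inr (Bp.form.dualBasis hBp y j), map_add,
      bracket_inr_inl hg (hy j) (bracketFst_mem hg (hY j) (hy i)), bracket_inr_inr, prodForm_apply,
      ← mul_add, ← map_add]
    simp only [Prod.snd_add, map_zero, LinearMap.zero_apply, zero_add]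
    rw [add_comm]
  have e1 : ∀ i, (x.prod y) (Sum.inl i) = (x i, 0) := fun i => by ext <;> simp
  have e2 : ∀ j, (x.prod y) (Sum.inr j) = (0, y j) := fun j => by ext <;> simp
  -- Three pieces yield $\operatorname{str}C_{\mathfrak p}$: $\mathfrak p$ acting on $\mathfrak r$
  -- (`S1`), $\mathfrak p$ on $\mathfrak p$ through $\mathfrak r$ (`S2`), and $\mathfrak r$ on
  -- $\mathfrak p$ (`S4`). The rest are `S3` and the Casimir operator of $\mathfrak r$ on itself.
  have S1 := sum_form_bracketFst hg hν hBr hBp x hx y hy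
  have S2 := sum_form_action_bracketFst hg hν hBr hBp x hx y hy
  have S3 := sum_form_bracketSnd hg hBp y hy
  have S4 := str_eq_sum Bp hBp y hy (casimirEnd ν Br hBr x)
  rw [Finset.sum_comm] at S1 S2
  rw [Finset.sum_comm (f := fun j i => ksign (d i) (d i) * _)] at S3
  rw [str_eq_sum (prodForm Br Bp) hB (x.prod y) hxy, str_eq_sum Br hBr x hx]
  simp only [casimirEnd_apply, map_sum, Finset.mul_sum] at S4
  simp only [casimirEnd_apply, map_sum, Fintype.sum_sum_type, Finset.mul_sum, Sum.elim_inl,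
    Sum.elim_inr, dualBasis_prod_inl hBr x y hB, dualBasis_prod_inr hBp x y hB, map_add,
    mul_add, Finset.sum_add_distrib, e1, e2, h1, hg.subalgebra, hg.action, S1, S2, S3]
  simp only [prodForm_apply, map_zero, add_zero, zero_add, ← S4]
  ring

end Trace

end LieSuperType

end

end LieSuper

end

/-! ### The descent and the value of the constant. -/

theorem theorem4p2
    {r p : Type*} [AddCommGroup r] [Module ℂ r] [AddCommGroup p] [Module ℂ p]
    (𝓇 : ZMod 2 → Submodule ℂ r) [DirectSum.Decomposition 𝓇]
    (𝓅 : ZMod 2 → Submodule ℂ p) [DirectSum.Decomposition 𝓅]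
    -- the quadratic Lie superalgebra `r`
    (br : r →ₗ[ℂ] r →ₗ[ℂ] r) (Br : LieSuper.SuperForm 𝓇)
    (hr : LieSuper.IsQuadratic 𝓇 br Br)
    -- the super vector space `p` with its form, and the representation `ν : r → osp(p)`
    (Bp : LieSuper.SuperForm 𝓅) (hBp : Bp.form.Nondegenerate)
    (ν : r →ₗ[ℂ] Module.End ℂ p) (hν : LieSuper.IsOspRepresentation 𝓇 𝓅 br Bp ν)
    -- the bracket of `g = r ⊕ p`
    (brg : (r × p) →ₗ[ℂ] (r × p) →ₗ[ℂ] (r × p))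
    (hg : LieSuper.IsLieSuperType br Br Bp ν brg)
    -- homogeneous bases of `r` and `p`
    {m n : Type*} [Fintype m] [DecidableEq m] [Fintype n] [DecidableEq n]
    (x : Module.Basis m ℂ r) (dx : m → ZMod 2) (hx : ∀ i, x i ∈ 𝓇 (dx i))
    (y : Module.Basis n ℂ p) (dy : n → ZMod 2) (hy : ∀ i, y i ∈ 𝓅 (dy i))
    -- the even cubic element `φ_p` to which the bracket of `g` corresponds
    (φp : LieSuper.SuperExterior 𝓅) (hφp : φp ∈ LieSuper.SuperExterior.gradedPart 𝓅 3 0)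
    (hbr : ∀ z₁ z₂ : r × p,
      LieSuper.SuperClifford.ι (LieSuper.prodGrading 𝓇 𝓅) 0 (brg z₁ z₂) =
        (2 : ℂ) • LieSuper.SuperClifford.contract 0 (LieSuper.prodForm Br Bp) z₁
          (LieSuper.SuperClifford.contract 0 (LieSuper.prodForm Br Bp) z₂
            (LieSuper.extInl (LieSuper.cubicElement br Br hr.nondegenerate x dx)
              + LieSuper.phiNu Br hr.nondegenerate x (LieSuper.nuStar ν Bp hBp y dy)
              + LieSuper.extInr φp))) :
    LieSuper.nuStarLift Bp (LieSuper.nuStar ν Bp hBp y dy)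
        (LieSuper.casimirTensor Br.form hr.nondegenerate x)
      + (LieSuper.SuperClifford.eta Bp).symm φp ^ 2
      = algebraMap ℂ (LieSuper.SuperClifford 𝓅 Bp)
        ((1 / 24 : ℂ) *
          (LieSuper.str (LieSuper.prodGrading 𝓇 𝓅)
              (LieSuper.adU (LieSuper.prodGrading 𝓇 𝓅) hg.toIsLieSuperalgebra
                (LieSuper.casimir (LieSuper.prodGrading 𝓇 𝓅) brg
                  (LieSuper.prodForm Br Bp).form hg.nondegenerate (x.prod y)))
            - LieSuper.str 𝓇
              (LieSuper.adU 𝓇 hr.toIsLieSuperalgebra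
                (LieSuper.casimir 𝓇 br Br.form hr.nondegenerate x)))) := by
  have hBr := hr.nondegenerate
  set φ := (LieSuper.SuperClifford.eta Bp).symm φp with hφ
  have hηφ : LieSuper.SuperClifford.eta Bp φ = φp := LinearEquiv.apply_symm_apply _ _
  have hodd : ∀ a, LieSuper.SuperClifford.signAut Bp a φ = -φ := by
    intro a
    apply (LieSuper.SuperClifford.eta Bp).injective
    rw [LieSuper.SuperClifford.eta_signAut, map_neg, hηφ,
      LieSuper.SuperExterior.signAut_of_mem_gradedPart hφp, LieSuper.ksign_zero_right]
    module
  have hE : LieSuper.SuperExterior.euler Bp hBp y dy (LieSuper.SuperClifford.eta Bp φ)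
      = (3 : ℂ) • LieSuper.SuperClifford.eta Bp φ := by
    rw [hηφ]
    exact_mod_cast LieSuper.SuperExterior.euler_of_mem_gradedPart Bp hBp y hy hφp
  have hm := LieSuper.bracketSnd_eq_of_cubic (brg := brg) x dx hBr
    (LieSuper.nuStar ν Bp hBp y dy) hbr
  have hgr := LieSuper.bracketSnd_mem hg
  have hρ := LieSuper.form_bracketFst hg
  have hρg := LieSuper.bracketFst_mem hg
  rw [sq, LieSuper.adU_casimir (LieSuper.prodForm Br Bp) hg.nondegenerate,
    LieSuper.adU_casimir Br hr.nondegenerate,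
    LieSuper.SuperClifford.eq_algebraMap_constTerm hBp y hy
      (w := LieSuper.nuStarLift Bp _ _ + φ * φ)]
  -- The constant: $\frac18=\frac3{24}$ matches the three copies of $\operatorname{str}C_{\mathfrak
  -- p}$.
  · congr 1
    rw [map_add, LieSuper.constTerm_casimir hν hBr hBp x hx y hy,
      LieSuper.SuperClifford.constTerm_cubic_sq hBp y hy hodd hm hgr hE,
      LieSuper.str_casimirEnd_prod hg hν hBr hBp x hx y hy, Finset.sum_comm]
    ring
  intro a v hv
  refine LieSuper.SuperClifford.eq_zero_of_contract_eq_zero hBp y hy ?_ fun b w hw => ?_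
  -- `signAut Bp 0` is the degree involution; it fixes products of two elements of even degree and
  -- the square of an element of odd degree.
  · refine LieSuper.SuperClifford.constTerm_contract_eq_zero ?_ hv
    have hX := LieSuper.dualBasis_mem Br hBr x dx hx
    rw [map_add, map_mul, hodd, neg_mul_neg, LieSuper.nuStarLift_casimirTensor, map_sum]
    congr 1
    refine Finset.sum_congr rfl fun i _ => ?_
    rw [map_mul, LieSuper.signAut_nuStar hν hBp y hy (hx i),
      LieSuper.signAut_nuStar hν hBp y hy (hX i), LieSuper.ksign_zero_left, one_smul, one_smul]
  refine LieSuper.SuperClifford.eq_zero_of_contract_eq_zero hBp y hy ?_ fun c u hu => ?_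
  · rw [map_add, map_add, map_add,
      LieSuper.constTerm_contract_contract_casimir hν hBr hBp x hx y hy hρ hρg hv hw,
      LieSuper.SuperClifford.constTerm_contract_contract_sq hBp y hy hodd hm hgr hE hv hw, add_zero]
  · rw [map_add, map_add, map_add,
      LieSuper.contract_contract_contract_casimir hν hBr hBp x hx y hy hρ hρg hv hw hu,
      LieSuper.SuperClifford.contract_contract_contract_sq hodd hm hgr hv hw hu, ← map_add,
      ← smul_add]
    -- The two triple contractions add up to half the Jacobi identity `hJ`, once `hs` turns
    -- $[[u,v],w]$ into $[w,[u,v]]$ within $\mathfrak p$; `hk` and `hk'` reconcile the signs.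
    have hJ := LieSuper.jacobi_snd hg hv hw hu
    have hs := LieSuper.bracketSnd_skew hg (hgr hu hv) hw
    have hk : LieSuper.ksign b a * LieSuper.ksign (c + a) b = LieSuper.ksign c b := by
      rw [LieSuper.ksign_add_left, LieSuper.ksign_comm b a]
      linear_combination LieSuper.ksign c b * LieSuper.ksign_mul_self a b
    have hk' : LieSuper.ksign c b * LieSuper.ksign b (c + a) = LieSuper.ksign b a := by
      rw [LieSuper.ksign_add_right, LieSuper.ksign_comm c b]
      linear_combination LieSuper.ksign b a * LieSuper.ksign_mul_self b c
    rw [hs, smul_neg, smul_smul, hk, LieSuper.ksign_comm _ c]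
    rw [smul_sub, smul_smul, hk', ← sub_eq_zero] at hJ
    have hz := congrArg (fun z => LieSuper.SuperClifford.ι 𝓅 Bp ((1 / 2 : ℂ) • z)) hJ
    simp only [smul_zero, map_zero] at hz
    rw [← hz]
    congr 2
    abel
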